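/- Let $\psi_k,\psi^*_k$ ($k\in\mathbb Z$) be the free fermions, $[\psi_k,\psi_m]_+=[\psi^*_k,\psi^*_m]_+=0$, $[\psi_k,\psi^*_m]_+=\delta_{km}$, acting on the left on the (completed) fermionic Fock space of kets over a commutative $\mathbb Q$-algebra $R$ (for instance $R=\mathbb C$), whose basis states are given by the sets of occupied modes containing almost all negative and almost no non-negative integers ($\psi_k$ fills and $\psi^*_k$ empties the mode $k$, with the sign $(-1)^{\#\{\text{occupied modes}>k\}}$), and acting on the right on the dual space of bras. Let $|0\rangle$ be the Dirac vacuum ($\psi_k|0\rangle=0$ for $k<0$, $\psi^*_k|0\rangle=0$ for $k\ge 0$) and $\langle 0|$ its dual, $\langle 0|0\rangle=1$. For $n\in\mathbb Z$ put $$|n\rangle=\begin{cases}\psi_{n-1}\cdots\psi_1\psi_0|0\rangle,& n\ge 0,\\ \psi^*_n\cdots\psi^*_{-2}\psi^*_{-1}|0\rangle,& n<0,\end{cases}\qquad \langle n|=\begin{cases}\langle 0|\psi^*_0\psi^*_1\cdots\psi^*_{n-1},& n\ge 0,\\ \langle 0|\psi_{-1}\psi_{-2}\cdots\psi_n,& n<0.\end{cases}$$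 For a Young diagram $\lambda$ with $\ell(\lambda)$ non-zero rows, with $d=d(\lambda)$ boxes on the main diagonal and with Frobenius coordinates $\alpha_i=\lambda_i-i$, $\beta_i=\lambda'_i-i$ ($1\le i\le d$), put $$|\lambda,n\rangle=\psi^*_{n-\beta_1-1}\cdots\psi^*_{n-\beta_d-1}\,\psi_{n+\alpha_d}\cdots\psi_{n+\alpha_1}|n\rangle,\qquad \langle\lambda,n|=\langle n|\psi^*_{n+\alpha_1}\cdots\psi^*_{n+\alpha_d}\,\psi_{n-\beta_d-1}\cdots\psi_{n-\beta_1-1},$$ and $b(\lambda)=\sum_{i=1}^{d}(\beta_i+1)$. Let $t=(t_1,t_2,\dots)$ be arbitrary elements of $R$, and let $$J_k=\sum_{j\in\mathbb Z}\psi_j\psi^*_{j+k}\ (k\ne 0),\qquad J_-(t)=\sum_{k\ge1}t_kJ_{-k},\qquad J_+(t)=\sum_{k\ge1}t_kJ_k .$$ Define $h_k(t)$ by $\exp\big(\sum_{k\ge1}t_kz^k\big)=\sum_{k\ge0}h_k(t)z^k$, with $h_k=0$ for $k<0$, and the Schur polynomials by $s_\lambda(t)=\det_{1\le i,j\le\ell(\lambda)}h_{\lambda_i-i+j}(t)$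 (so $s_\emptyset=1$). Then for every $n\in\mathbb Z$ $$e^{J_-(t)}|n\rangle=\sum_{\lambda}(-1)^{b(\lambda)}s_\lambda(t)\,|\lambda,n\rangle,\qquad \langle n|e^{J_+(t)}=\sum_{\lambda}(-1)^{b(\lambda)}s_\lambda(t)\,\langle\lambda,n|,$$ where the sums run over all Young diagrams including the empty one. All infinite sums of states are formal: for every basis state only finitely many terms contribute to its coefficient. Equivalently, for every $n\in\mathbb Z$ and every Young diagram $\lambda$, $$\langle\lambda,n|e^{J_-(t)}|n\rangle=(-1)^{b(\lambda)}s_\lambda(t),\qquad \langle n|e^{J_+(t)}|\lambda,n\rangle=(-1)^{b(\lambda)}s_\lambda(t).$$ -/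

import Mathlib

namespace FermiFock

/-! ### The fermionic Fock space -/

/-- A Maya diagram: the set `occ` of occupied modes of a basis state of the fermionic Fock space.
Almost all negative modes are occupied and almost all non-negative modes are empty. -/
@[ext]
structure Maya where
  occ : Set ℤ
  finite_particles : {k : ℤ | k ∈ occ ∧ 0 ≤ k}.Finite
  finite_holes : {k : ℤ | k ∉ occ ∧ k < 0}.Finite

namespace Maya

/-- Fill the mode `k`. -/
def insert (S : Maya) (k : ℤ) : Maya where
  occ := Insert.insert k S.occ
  finite_particles := (S.finite_particles.insert k).subset (by
    rintro x ⟨hx | hx, h0⟩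
    · exact Or.inl hx
    · exact Or.inr ⟨hx, h0⟩)
  finite_holes := S.finite_holes.subset (by
    rintro x ⟨hx, h0⟩
    exact ⟨fun h => hx (Or.inr h), h0⟩)

/-- Empty the mode `k`. -/
def erase (S : Maya) (k : ℤ) : Maya where
  occ := S.occ \ {k}
  finite_particles := S.finite_particles.subset (by
    rintro x ⟨hx, h0⟩
    exact ⟨hx.1, h0⟩)
  finite_holes := (S.finite_holes.insert k).subset (by
    rintro x ⟨hx, h0⟩
    by_cases h : x = k
    · exact Or.inl h
    · exact Or.inr ⟨fun h' => hx ⟨h', h⟩, h0⟩)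

/-- The Dirac sea: exactly the negative modes are occupied. -/
def dirac : Maya where
  occ := Set.Iio 0
  finite_particles := Set.finite_empty.subset (by
    rintro x ⟨hx, h0⟩
    exact absurd hx (not_lt.mpr h0))
  finite_holes := Set.finite_empty.subset (by
    rintro x ⟨hx, h0⟩
    exact absurd h0 hx)

/-- The (finite) number of occupied modes above `k`. -/
noncomputable def above (S : Maya) (k : ℤ) : ℕ := {s : ℤ | s ∈ S.occ ∧ k < s}.ncard

end Maya

/-- Kets: formal (possibly infinite) linear combinations `∑ v S |S⟩` of the basis kets `|S⟩`,
where `|S⟩` is the wedge product of the occupied modes in decreasing order. -/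
abbrev Ket (R : Type*) := Maya → R

/-- Bras: formal (possibly infinite) linear combinations `∑ U S ⟨S|` of the dual basis. -/
abbrev Bra (R : Type*) := Maya → R

section Fermions

variable {R : Type*} [CommRing R]

open Classical in
/-- `ψ_k v`. On basis kets: `ψ_k |T⟩ = (-1)^(number of s ∈ T with s > k) |T ∪ {k}⟩` if `k ∉ T`,
and `ψ_k |T⟩ = 0` if `k ∈ T`. -/
noncomputable def psiKet (k : ℤ) (v : Ket R) : Ket R := fun S =>
  if k ∈ S.occ then (-1) ^ S.above k * v (S.erase k) else 0

open Classical in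
/-- `ψ*_k v`. On basis kets: `ψ*_k |T⟩ = (-1)^(number of s ∈ T with s > k) |T \ {k}⟩` if `k ∈ T`,
and `ψ*_k |T⟩ = 0` if `k ∉ T`. -/
noncomputable def psiStarKet (k : ℤ) (v : Ket R) : Ket R := fun S =>
  if k ∈ S.occ then 0 else (-1) ^ S.above k * v (S.insert k)

open Classical in
/-- The right action `U ψ_k` on bras: `(U ψ_k)|S⟩ = U (ψ_k |S⟩)`. -/
noncomputable def psiBra (U : Bra R) (k : ℤ) : Bra R := fun S =>
  if k ∈ S.occ then 0 else (-1) ^ S.above k * U (S.insert k)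

open Classical in
/-- The right action `U ψ*_k` on bras: `(U ψ*_k)|S⟩ = U (ψ*_k |S⟩)`. -/
noncomputable def psiStarBra (U : Bra R) (k : ℤ) : Bra R := fun S =>
  if k ∈ S.occ then (-1) ^ S.above k * U (S.erase k) else 0

/-- The pairing `⟨U|V⟩` for which the basis kets `|S⟩` and the bras `⟨S|` are dual to each other.
It is used only where one of `U`, `V` has finite support. -/
noncomputable def pairing (U : Bra R) (V : Ket R) : R := ∑ᶠ S : Maya, U S * V S

open Classical in
/-- The Dirac vacuum `|0⟩`. -/
noncomputable def ketZero : Ket R := fun S => if S = Maya.dirac then 1 else 0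

open Classical in
/-- The dual Dirac vacuum `⟨0|`. -/
noncomputable def braZero : Bra R := fun S => if S = Maya.dirac then 1 else 0

end Fermions

/-- The symbols `ψ_k` and `ψ*_k`. -/
inductive Fermion
  | psi (k : ℤ)
  | psiStar (k : ℤ)

section States

variable {R : Type*} [CommRing R]

/-- Left action of `ψ_k`, `ψ*_k` on kets. -/
noncomputable def Fermion.ket : Fermion → Ket R → Ket R
  | .psi k, v => psiKet k v
  | .psiStar k, v => psiStarKet k v

/-- Right action of `ψ_k`, `ψ*_k` on bras. -/
noncomputable def Fermion.bra (U : Bra R) : Fermion → Bra R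
  | .psi k => psiBra U k
  | .psiStar k => psiStarBra U k

/-- `f₁ f₂ ⋯ f_r v` (the rightmost factor acts first). -/
noncomputable def wordKet (w : List Fermion) (v : Ket R) : Ket R := w.foldr Fermion.ket v

/-- `U f₁ f₂ ⋯ f_r` (the leftmost factor acts first). -/
noncomputable def wordBra (U : Bra R) (w : List Fermion) : Bra R := w.foldl Fermion.bra U

/-- The shifted vacuum `|n⟩`: it is `ψ_{n-1} ⋯ ψ_1 ψ_0 |0⟩` for `n ≥ 0` and
`ψ*_n ⋯ ψ*_{-2} ψ*_{-1} |0⟩` for `n < 0`. -/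
noncomputable def ketVac (n : ℤ) : Ket R :=
  if 0 ≤ n then
    wordKet ((List.range n.toNat).map fun i => Fermion.psi i).reverse ketZero
  else
    wordKet ((List.range (-n).toNat).map fun i => Fermion.psiStar (-i - 1)).reverse ketZero

/-- The shifted dual vacuum `⟨n|`: it is `⟨0| ψ*_0 ψ*_1 ⋯ ψ*_{n-1}` for `n ≥ 0` and
`⟨0| ψ_{-1} ψ_{-2} ⋯ ψ_n` for `n < 0`. -/
noncomputable def braVac (n : ℤ) : Bra R :=
  if 0 ≤ n then
    wordBra braZero ((List.range n.toNat).map fun i => Fermion.psiStar i)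
  else
    wordBra braZero ((List.range (-n).toNat).map fun i => Fermion.psi (-i - 1))

/-! ### Frobenius coordinates and the basis states -/

/-- `d(μ)`, the number of boxes on the main diagonal. -/
def diagLen (μ : YoungDiagram) : ℕ := (μ.cells.filter fun c => c.1 = c.2).card

/-- The Frobenius coordinate `α_{i+1} = μ_{i+1} - (i+1)`, for `i < d(μ)`
(rows are counted from `0` by `rowLen`, and the subtraction does not truncate for `i < d(μ)`). -/
def frobAlpha (μ : YoungDiagram) (i : ℕ) : ℕ := μ.rowLen i - (i + 1)

/-- The Frobenius coordinate `β_{i+1} = μ'_{i+1} - (i+1)`, for `i < d(μ)`. -/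
def frobBeta (μ : YoungDiagram) (i : ℕ) : ℕ := μ.colLen i - (i + 1)

/-- `b(μ) = ∑_{i=1}^{d(μ)} (β_i + 1)`. -/
def bNum (μ : YoungDiagram) : ℕ := ∑ i ∈ Finset.range (diagLen μ), (frobBeta μ i + 1)

/-- `|μ, n⟩ = ψ*_{n-β_1-1} ⋯ ψ*_{n-β_d-1} ψ_{n+α_d} ⋯ ψ_{n+α_1} |n⟩`. -/
noncomputable def ketState (μ : YoungDiagram) (n : ℤ) : Ket R :=
  wordKet
    (((List.range (diagLen μ)).map fun i => Fermion.psiStar (n - frobBeta μ i - 1)) ++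
      ((List.range (diagLen μ)).map fun i => Fermion.psi (n + frobAlpha μ i)).reverse)
    (ketVac n)

/-- `⟨μ, n| = ⟨n| ψ*_{n+α_1} ⋯ ψ*_{n+α_d} ψ_{n-β_d-1} ⋯ ψ_{n-β_1-1}`. -/
noncomputable def braState (μ : YoungDiagram) (n : ℤ) : Bra R :=
  wordBra (braVac n)
    (((List.range (diagLen μ)).map fun i => Fermion.psiStar (n + frobAlpha μ i)) ++
      ((List.range (diagLen μ)).map fun i => Fermion.psi (n - frobBeta μ i - 1)).reverse)

/-! ### Currents and coherent states -/

/-- `J_k v = ∑_j ψ_j ψ*_{j+k} v`, used for `k ≠ 0` only (no normal ordering is needed then). -/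
noncomputable def currentKet (k : ℤ) (v : Ket R) : Ket R := fun S =>
  ∑ᶠ j : ℤ, psiKet j (psiStarKet (j + k) v) S

/-- `U J_k = ∑_j U ψ_j ψ*_{j+k}`, used for `k ≠ 0` only. -/
noncomputable def currentBra (U : Bra R) (k : ℤ) : Bra R := fun S =>
  ∑ᶠ j : ℤ, psiStarBra (psiBra U j) (j + k) S

/-- `J_-(t) v = ∑_{k ≥ 1} t_k J_{-k} v`. -/
noncomputable def JMinus (t : ℕ → R) (v : Ket R) : Ket R := fun S =>
  ∑ᶠ k : ℕ, t (k + 1) * currentKet (-((k : ℤ) + 1)) v S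

/-- `U J_+(t) = ∑_{k ≥ 1} t_k U J_k`. -/
noncomputable def JPlus (t : ℕ → R) (U : Bra R) : Bra R := fun S =>
  ∑ᶠ k : ℕ, t (k + 1) * currentBra U ((k : ℤ) + 1) S

/-- `e^{J_-(t)} v = ∑_m (1 / m!) J_-(t)^m v`. -/
noncomputable def expJMinus [Algebra ℚ R] (t : ℕ → R) (v : Ket R) : Ket R := fun S =>
  ∑ᶠ m : ℕ, ((m.factorial : ℚ)⁻¹) • ((JMinus t)^[m] v) S

/-- `U e^{J_+(t)} = ∑_m (1 / m!) U J_+(t)^m`. -/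
noncomputable def expJPlus [Algebra ℚ R] (t : ℕ → R) (U : Bra R) : Bra R := fun S =>
  ∑ᶠ m : ℕ, ((m.factorial : ℚ)⁻¹) • ((JPlus t)^[m] U) S

/-- The formal series `∑ i, f i` of kets (or bras) converges to `a`: for every basis state only
finitely many terms contribute to its coefficient, and these add up to the coefficient in `a`. -/
def IsFormalSum {ι : Type*} (f : ι → Maya → R) (a : Maya → R) : Prop :=
  ∀ S : Maya, (Function.support fun i => f i S).Finite ∧ ∑ᶠ i, f i S = a S

/-! ### Schur polynomials -/

/-- `ξ(t, z) = ∑_{k ≥ 1} t_k z^k`. -/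
noncomputable def xi (t : ℕ → R) : PowerSeries R := PowerSeries.mk fun k => if k = 0 then 0 else t k

/-- `h_k(t)` for `k : ℤ`, where `exp (ξ(t, z)) = ∑_{k ≥ 0} h_k(t) z^k` and `h_k = 0` for `k < 0`. -/
noncomputable def hPoly [Algebra ℚ R] (t : ℕ → R) (k : ℤ) : R :=
  if 0 ≤ k then PowerSeries.coeff k.toNat ((PowerSeries.exp R).subst (xi t)) else 0

/-- The Schur polynomial `s_μ(t) = det_{1 ≤ i, j ≤ ℓ(μ)} h_{μ_i - i + j}(t)`. -/
noncomputable def schur [Algebra ℚ R] (μ : YoungDiagram) (t : ℕ → R) : R :=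
  Matrix.det (Matrix.of fun i j : Fin (μ.colLen 0) =>
    hPoly t ((μ.rowLen i : ℤ) - (i : ℕ) + (j : ℕ)))

end States

/-! ### Consistency of the definitions

The operators satisfy the defining relations of the Clifford algebra, the right action on bras is
adjoint to the left action on kets, the vacua have the required properties, the substitution in
the definition of `h_k` is legitimate, and all the infinite sums above are sums with finitely many
non-zero terms. -/

namespace Maya

theorem mem_insert {S : Maya} {k x : ℤ} : x ∈ (S.insert k).occ ↔ x = k ∨ x ∈ S.occ := Iff.rfl

theorem mem_erase {S : Maya} {k x : ℤ} : x ∈ (S.erase k).occ ↔ x ∈ S.occ ∧ x ≠ k := Iff.rfl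

theorem exists_bounds (S : Maya) : ∃ a b : ℤ, (∀ k < a, k ∈ S.occ) ∧ ∀ k ∈ S.occ, k ≤ b := by
  obtain ⟨a, ha⟩ := S.finite_holes.bddBelow
  obtain ⟨b, hb⟩ := S.finite_particles.bddAbove
  refine ⟨min a 0, max b 0, fun k hk => ?_, fun k hk => ?_⟩
  · by_contra h
    have := ha ⟨h, lt_of_lt_of_le hk (min_le_right _ _)⟩
    exact absurd (lt_of_lt_of_le hk (min_le_left _ _)) (not_lt.mpr this)
  · by_contra h
    have h' := max_lt_iff.mp (not_le.mp h)
    exact absurd (hb ⟨hk, h'.2.le⟩) (not_le.mpr h'.1)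

theorem finite_above (S : Maya) (k : ℤ) : {s : ℤ | s ∈ S.occ ∧ k < s}.Finite := by
  obtain ⟨a, b, -, hb⟩ := S.exists_bounds
  exact (Set.finite_Icc k b).subset fun s hs => ⟨hs.2.le, hb s hs.1⟩

theorem above_insert {S : Maya} {m : ℤ} (hm : m ∉ S.occ) (k : ℤ) :
    (S.insert m).above k = S.above k + if k < m then 1 else 0 := by
  unfold above
  split_ifs with h
  · rw [← Set.ncard_insert_of_notMem (a := m) (fun h' => hm h'.1) (S.finite_above k)]
    congr 1
    ext x
    simp only [mem_insert, Set.mem_ofPred_eq, Set.mem_insert_iff]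
    constructor
    · rintro ⟨rfl | hx, hk⟩ <;> tauto
    · rintro (rfl | hx) <;> tauto
  · rw [add_zero]
    congr 1
    ext x
    simp only [mem_insert, Set.mem_ofPred_eq]
    constructor
    · rintro ⟨rfl | hx, hk⟩ <;> tauto
    · tauto

theorem insert_erase {S : Maya} {m : ℤ} (hm : m ∈ S.occ) : (S.erase m).insert m = S := by
  ext x
  simp only [mem_insert, mem_erase]
  by_cases h : x = m
  · subst h; tauto
  · tauto

theorem erase_insert {S : Maya} {m : ℤ} (hm : m ∉ S.occ) : (S.insert m).erase m = S := by
  ext x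
  simp only [mem_insert, mem_erase]
  by_cases h : x = m
  · subst h; tauto
  · tauto

theorem above_erase {S : Maya} {m : ℤ} (hm : m ∈ S.occ) (k : ℤ) :
    S.above k = (S.erase m).above k + if k < m then 1 else 0 := by
  conv_lhs => rw [← insert_erase hm]
  exact above_insert (S := S.erase m) (fun h => (mem_erase.mp h).2 rfl) k

theorem erase_comm (S : Maya) (m k : ℤ) : (S.erase m).erase k = (S.erase k).erase m := by
  ext x
  simp only [mem_erase]
  tauto

theorem insert_comm (S : Maya) (m k : ℤ) : (S.insert m).insert k = (S.insert k).insert m := by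
  ext x
  simp only [mem_insert]
  tauto

theorem insert_erase_comm (S : Maya) {m k : ℤ} (h : m ≠ k) :
    (S.insert m).erase k = (S.erase k).insert m := by
  ext x
  simp only [mem_insert, mem_erase]
  by_cases hx : x = m
  · subst hx; tauto
  · tauto

/-- The energy of a basis state: the sum of `k` over the particles `k ≥ 0` and of `-k` over the
holes `k < 0`. -/
noncomputable def energy (S : Maya) : ℤ := by
  classical
  exact ∑ᶠ k : ℤ, ((if k ∈ S.occ then k else 0) - if k < 0 then k else 0)

theorem energy_nonneg (S : Maya) : 0 ≤ S.energy := by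
  classical
  unfold energy
  refine finsum_nonneg fun k => ?_
  split_ifs <;> omega

theorem energy_move {S : Maya} {i j : ℤ} (hj : j ∈ S.occ) (hi : i ∉ S.occ) :
    ((S.erase j).insert i).energy = S.energy + (i - j) := by
  classical
  have hij : i ≠ j := fun h => hi (h ▸ hj)
  have fin1 : (Function.support fun k : ℤ =>
      ((if k ∈ S.occ then k else 0) - if k < 0 then k else 0)).Finite := by
    refine (S.finite_particles.union S.finite_holes).subset fun k hk => ?_
    simp only [Function.mem_support] at hk
    by_cases h1 : k ∈ S.occ <;> by_cases h2 : k < 0 <;> simp [h1, h2] at hk ⊢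
    omega
  have fin2 : ∀ a : ℤ, (Function.support fun k : ℤ => if k = a then a else 0).Finite := fun a =>
    (Set.finite_singleton a).subset fun k hk => by
      by_contra h
      exact hk (if_neg h)
  have one : ∀ a : ℤ, ∑ᶠ k : ℤ, (if k = a then a else 0) = a := fun a => by
    rw [finsum_eq_single _ a fun k hk => if_neg hk, if_pos rfl]
  have key : i - j = ∑ᶠ k : ℤ, ((if k = i then i else 0) - if k = j then j else 0) := by
    rw [finsum_sub_distrib (fin2 i) (fin2 j), one, one]
  unfold energy
  rw [key, ← finsum_add_distrib fin1]
  · refine finsum_congr fun k => ?_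
    simp only [mem_insert, mem_erase]
    by_cases h1 : k = i
    · subst h1
      simp [hi, hij]
      ring
    · by_cases h2 : k = j
      · subst h2
        simp [hj, h1]
        ring
      · simp [h1, h2]
  · exact ((fin2 i).union (fin2 j)).subset (Function.support_sub _ _)

end Maya

section Consistency

variable {R : Type*} [CommRing R]

theorem psiKet_anticomm (m n : ℤ) (v : Ket R) :
    psiKet m (psiKet n v) + psiKet n (psiKet m v) = 0 := by
  funext S
  by_cases hmn : m = n
  · subst hmn
    simp [psiKet, Maya.mem_erase]
  by_cases hm : m ∈ S.occ
  swap
  · simp [psiKet, hm, Maya.mem_erase]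
  by_cases hn : n ∈ S.occ
  swap
  · simp [psiKet, hn, Maya.mem_erase]
  have e1 := Maya.above_erase hm n
  have e2 := Maya.above_erase hn m
  simp only [psiKet, Pi.add_apply, hm, hn, Maya.mem_erase, Ne.symm hmn, ne_eq, hmn,
    not_false_eq_true, and_self, if_true, Maya.erase_comm S m n, e1, e2, Pi.zero_apply]
  rcases lt_or_gt_of_ne hmn with h | h <;> simp [h, not_lt.mpr h.le, pow_succ] <;> ring

theorem psiStarKet_anticomm (m n : ℤ) (v : Ket R) :
    psiStarKet m (psiStarKet n v) + psiStarKet n (psiStarKet m v) = 0 := by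
  funext S
  by_cases hmn : m = n
  · subst hmn
    simp [psiStarKet, Maya.mem_insert]
  by_cases hm : m ∈ S.occ
  · simp [psiStarKet, hm, Maya.mem_insert]
  by_cases hn : n ∈ S.occ
  · simp [psiStarKet, hn, Maya.mem_insert]
  have e1 := Maya.above_insert hm n
  have e2 := Maya.above_insert hn m
  simp only [psiStarKet, Pi.add_apply, hm, hn, Maya.mem_insert, Ne.symm hmn, hmn,
    or_self, if_false, Maya.insert_comm S m n, e1, e2, Pi.zero_apply]
  rcases lt_or_gt_of_ne hmn with h | h <;> simp [h, not_lt.mpr h.le, pow_succ] <;> ring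

theorem psiKet_psiStarKet_anticomm (m n : ℤ) (v : Ket R) :
    psiKet m (psiStarKet n v) + psiStarKet n (psiKet m v) = if m = n then v else 0 := by
  funext S
  by_cases hmn : m = n
  · subst hmn
    by_cases hm : m ∈ S.occ
    · have e := Maya.above_erase hm m
      simp [psiKet, psiStarKet, hm, Maya.mem_erase, e, Maya.insert_erase hm, ← mul_assoc,
        ← mul_pow]
    · have e := Maya.above_insert hm m
      simp [psiKet, psiStarKet, hm, Maya.mem_insert, e, Maya.erase_insert hm, ← mul_assoc,
        ← mul_pow]
  by_cases hm : m ∈ S.occ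
  swap
  · simp [psiKet, psiStarKet, hm, hmn, Maya.mem_insert]
  by_cases hn : n ∈ S.occ
  · simp [psiKet, psiStarKet, hn, hmn, Maya.mem_erase, Ne.symm hmn]
  have e1 := Maya.above_erase hm n
  have e2 := Maya.above_insert hn m
  simp only [psiKet, psiStarKet, Pi.add_apply, hm, hn, Maya.mem_erase, Maya.mem_insert, hmn,
    or_true, false_and, if_true, if_false, e1, e2, Pi.zero_apply,
    Maya.insert_erase_comm S (Ne.symm hmn)]
  rcases lt_or_gt_of_ne hmn with h | h <;> simp [h, not_lt.mpr h.le, pow_succ] <;> ring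

theorem pairing_psi (U : Bra R) (k : ℤ) (v : Ket R) :
    pairing (psiBra U k) v = pairing U (psiKet k v) := by
  classical
  have h1 : pairing (psiBra U k) v =
      ∑ᶠ S ∈ {S : Maya | k ∉ S.occ}, (-1) ^ S.above k * U (S.insert k) * v S := by
    refine finsum_congr fun S => ?_
    by_cases h : k ∈ S.occ <;> simp [psiBra, h]
  have h2 : pairing U (psiKet k v) =
      ∑ᶠ S ∈ {S : Maya | k ∈ S.occ}, U S * ((-1) ^ S.above k * v (S.erase k)) := by
    refine finsum_congr fun S => ?_
    by_cases h : k ∈ S.occ <;> simp [psiKet, h]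
  rw [h1, h2]
  refine finsum_mem_eq_of_bijOn (fun S => S.insert k) ⟨?_, ?_, ?_⟩ ?_
  · exact fun S _ => Or.inl rfl
  · intro S hS T hT hST
    have := congrArg (fun X => Maya.erase X k) hST
    simpa [Maya.erase_insert (show k ∉ S.occ from hS),
      Maya.erase_insert (show k ∉ T.occ from hT)] using this
  · exact fun S hS => ⟨S.erase k, fun h => h.2 rfl, Maya.insert_erase hS⟩
  · intro S hS
    have hS' : k ∉ S.occ := hS
    simp only [Maya.erase_insert hS', Maya.above_insert hS', lt_irrefl, if_false, add_zero]
    ring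

theorem pairing_psiStar (U : Bra R) (k : ℤ) (v : Ket R) :
    pairing (psiStarBra U k) v = pairing U (psiStarKet k v) := by
  have h := pairing_psi v k U
  simp only [pairing, mul_comm] at h ⊢
  exact h.symm

theorem psi_ketZero {k : ℤ} (hk : k < 0) : psiKet k (ketZero : Ket R) = 0 := by
  funext S
  have : S.erase k ≠ Maya.dirac := fun h =>
    (show k ∉ (S.erase k).occ from fun h => h.2 rfl) (h ▸ hk)
  simp [psiKet, ketZero, this]

theorem psiStar_ketZero {k : ℤ} (hk : 0 ≤ k) : psiStarKet k (ketZero : Ket R) = 0 := by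
  funext S
  have : S.insert k ≠ Maya.dirac := fun h =>
    (show k ∉ Maya.dirac.occ from not_lt.mpr hk) (h ▸ Or.inl rfl)
  simp [psiStarKet, ketZero, this]

theorem braZero_psiStar {k : ℤ} (hk : k < 0) : psiStarBra (braZero : Bra R) k = 0 := psi_ketZero hk

theorem braZero_psi {k : ℤ} (hk : 0 ≤ k) : psiBra (braZero : Bra R) k = 0 := psiStar_ketZero hk

theorem pairing_zero_zero : pairing (braZero : Bra R) ketZero = 1 := by
  unfold pairing
  rw [finsum_eq_single _ Maya.dirac fun S hS => by simp [braZero, hS]]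
  simp [braZero, ketZero]

theorem support_wordKet_finite (w : List Fermion) {v : Ket R} (hv : (Function.support v).Finite) :
    (Function.support (wordKet w v)).Finite := by
  induction w with
  | nil => exact hv
  | cons f w ih =>
    cases f with
    | psi k =>
      refine (ih.image fun S => S.insert k).subset fun S hS => ?_
      change psiKet k (wordKet w v) S ≠ 0 at hS
      by_cases h : k ∈ S.occ
      · simp only [psiKet, h, if_true] at hS
        exact ⟨S.erase k, right_ne_zero_of_mul hS, Maya.insert_erase h⟩
      · simp [psiKet, h] at hS
    | psiStar k =>
      refine (ih.image fun S => S.erase k).subset fun S hS => ?_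
      change psiStarKet k (wordKet w v) S ≠ 0 at hS
      by_cases h : k ∈ S.occ
      · simp [psiStarKet, h] at hS
      · simp only [psiStarKet, h, if_false] at hS
        exact ⟨S.insert k, right_ne_zero_of_mul hS, Maya.erase_insert h⟩

theorem wordBra_eq (w : List Fermion) (U : Bra R) : wordBra U w =
    wordKet (w.map fun | .psi k => Fermion.psiStar k | .psiStar k => Fermion.psi k).reverse U := by
  induction w generalizing U with
  | nil => rfl
  | cons f w ih =>
    have : wordBra U (f :: w) = wordBra (Fermion.bra U f) w := rfl
    rw [this, ih, List.map_cons, List.reverse_cons, wordKet, wordKet, List.foldr_append]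
    cases f <;> rfl

theorem support_ketZero_finite : (Function.support (ketZero : Ket R)).Finite :=
  (Set.finite_singleton Maya.dirac).subset fun S hS => by
    by_contra h
    exact hS (if_neg h)

theorem support_ketState_finite (μ : YoungDiagram) (n : ℤ) :
    (Function.support (ketState μ n : Ket R)).Finite := by
  refine support_wordKet_finite _ ?_
  unfold ketVac
  split_ifs <;> exact support_wordKet_finite _ support_ketZero_finite

theorem support_braState_finite (μ : YoungDiagram) (n : ℤ) :
    (Function.support (braState μ n : Bra R)).Finite := by
  rw [braState, wordBra_eq]
  refine support_wordKet_finite _ ?_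
  unfold braVac
  split_ifs <;> rw [wordBra_eq] <;> exact support_wordKet_finite _ support_ketZero_finite

theorem current_term_ne_zero {i j : ℤ} (hij : i ≠ j) {v : Ket R} {S : Maya}
    (h : psiKet j (psiStarKet i v) S ≠ 0) :
    j ∈ S.occ ∧ i ∉ S.occ ∧ v ((S.erase j).insert i) ≠ 0 := by
  have hj : j ∈ S.occ := by
    by_contra h'
    simp [psiKet, h'] at h
  have hi : i ∉ S.occ := by
    intro h'
    simp [psiKet, psiStarKet, hj, Maya.mem_erase, h', hij] at h
  simp only [psiKet, psiStarKet, hj, Maya.mem_erase, hi, false_and, if_true, if_false] at h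
  exact ⟨hj, hi, right_ne_zero_of_mul (right_ne_zero_of_mul h)⟩

theorem currentKet_finite {k : ℤ} (hk : k ≠ 0) (v : Ket R) (S : Maya) :
    (Function.support fun j : ℤ => psiKet j (psiStarKet (j + k) v) S).Finite := by
  obtain ⟨a, b, ha, hb⟩ := S.exists_bounds
  refine (Set.finite_Icc (a - k) b).subset fun j hj => ?_
  obtain ⟨h1, h2, -⟩ := current_term_ne_zero (by omega) hj
  refine ⟨?_, hb j h1⟩
  by_contra h
  exact h2 (ha _ (by omega))

theorem currentBra_finite {k : ℤ} (hk : k ≠ 0) (U : Bra R) (S : Maya) :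
    (Function.support fun j : ℤ => psiStarBra (psiBra U j) (j + k) S).Finite := by
  obtain ⟨a, b, ha, hb⟩ := S.exists_bounds
  refine (Set.finite_Icc a (b - k)).subset fun j hj => ?_
  obtain ⟨h1, h2, -⟩ := current_term_ne_zero (i := j) (j := j + k) (v := U) (by omega) hj
  refine ⟨?_, by have := hb _ h1; omega⟩
  by_contra h
  exact h2 (ha _ (by omega))

theorem currentBra_apply (U : Bra R) (k : ℤ) : currentBra U k = currentKet (-k) U := by
  funext S
  unfold currentBra currentKet
  conv_rhs => rw [← finsum_comp_equiv (Equiv.addRight k)]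
  refine finsum_congr fun j => ?_
  simp only [Equiv.coe_addRight, add_neg_cancel_right]
  rfl

theorem JPlus_apply (t : ℕ → R) : JPlus t = JMinus t := by
  funext U S
  simp only [JPlus, JMinus, currentBra_apply]

theorem currentKet_ne_zero {k : ℕ} {v : Ket R} {S : Maya}
    (h : currentKet (-((k : ℤ) + 1)) v S ≠ 0) :
    ∃ i j : ℤ, i + k + 1 = j ∧ j ∈ S.occ ∧ i ∉ S.occ ∧ v ((S.erase j).insert i) ≠ 0 := by
  have : ∃ j : ℤ, psiKet j (psiStarKet (j + -((k : ℤ) + 1)) v) S ≠ 0 := by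
    by_contra! h'
    exact h ((finsum_congr h').trans finsum_zero)
  obtain ⟨j, hj⟩ := this
  exact ⟨_, j, by ring, current_term_ne_zero (by omega) hj⟩

theorem JMinus_finite (t : ℕ → R) (v : Ket R) (S : Maya) :
    (Function.support fun k : ℕ => t (k + 1) * currentKet (-((k : ℤ) + 1)) v S).Finite := by
  obtain ⟨a, b, ha, hb⟩ := S.exists_bounds
  refine (Set.finite_Iic (b - a).toNat).subset fun k hk => ?_
  obtain ⟨i, j, hij, hj, hi, -⟩ := currentKet_ne_zero (right_ne_zero_of_mul hk)
  have h1 := hb j hj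
  have h2 : a ≤ i := by
    by_contra h
    exact hi (ha _ (by omega))
  simp only [Set.mem_Iic]
  omega

theorem JPlus_finite (t : ℕ → R) (U : Bra R) (S : Maya) :
    (Function.support fun k : ℕ => t (k + 1) * currentBra U ((k : ℤ) + 1) S).Finite := by
  simpa only [currentBra_apply] using JMinus_finite t U S

theorem JMinus_iterate_ne_zero (t : ℕ → R) (v : Ket R) (m : ℕ) (S : Maya)
    (h : ((JMinus t)^[m] v) S ≠ 0) : (m : ℤ) ≤ S.energy := by
  induction m generalizing S with
  | zero => simpa using S.energy_nonneg
  | succ m ih =>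
    rw [Function.iterate_succ_apply'] at h
    have : ∃ k : ℕ, t (k + 1) * currentKet (-((k : ℤ) + 1)) ((JMinus t)^[m] v) S ≠ 0 := by
      by_contra! h'
      exact h ((finsum_congr h').trans finsum_zero)
    obtain ⟨k, hk⟩ := this
    obtain ⟨i, j, hij, hj, hi, hv⟩ := currentKet_ne_zero (right_ne_zero_of_mul hk)
    have h1 := ih _ hv
    rw [Maya.energy_move hj hi] at h1
    push_cast
    omega

theorem expJMinus_finite [Algebra ℚ R] (t : ℕ → R) (v : Ket R) (S : Maya) :
    (Function.support fun m : ℕ => ((m.factorial : ℚ)⁻¹) • ((JMinus t)^[m] v) S).Finite := by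
  refine (Set.finite_Iic S.energy.toNat).subset fun m hm => ?_
  have h : ((JMinus t)^[m] v) S ≠ 0 := fun h0 => hm (by simp [h0])
  have := JMinus_iterate_ne_zero t v m S h
  simp only [Set.mem_Iic]
  omega

theorem expJPlus_finite [Algebra ℚ R] (t : ℕ → R) (U : Bra R) (S : Maya) :
    (Function.support fun m : ℕ => ((m.factorial : ℚ)⁻¹) • ((JPlus t)^[m] U) S).Finite := by
  rw [JPlus_apply]
  exact expJMinus_finite t U S

theorem hasSubst_xi (t : ℕ → R) : PowerSeries.HasSubst (xi t) :=
  PowerSeries.HasSubst.of_constantCoeff_zero' (by simp [xi])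

theorem mem_diag_iff (μ : YoungDiagram) (i : ℕ) : i < diagLen μ ↔ (i, i) ∈ μ := by
  classical
  have hex : ∃ d, (d, d) ∉ μ := by
    obtain ⟨j, hj⟩ := μ.exists_notMem_row 0
    exact ⟨j, fun h => hj (μ.up_left_mem (Nat.zero_le _) le_rfl h)⟩
  have mem : ∀ a, (a, a) ∈ μ ↔ a < Nat.find hex := fun a => by
    constructor
    · intro h
      by_contra ha
      exact Nat.find_spec hex (μ.up_left_mem (not_lt.mp ha) (not_lt.mp ha) h)
    · exact fun h => not_not.mp (Nat.find_min hex h)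
  have himg : (μ.cells.filter fun c => c.1 = c.2) =
      (Finset.range (Nat.find hex)).image fun a => (a, a) := by
    ext ⟨x, y⟩
    simp only [Finset.mem_filter, YoungDiagram.mem_cells, Finset.mem_image, Finset.mem_range,
      Prod.mk.injEq]
    constructor
    · rintro ⟨h, rfl⟩
      exact ⟨x, (mem x).mp h, rfl, rfl⟩
    · rintro ⟨a, ha, rfl, rfl⟩
      exact ⟨(mem a).mpr ha, rfl⟩
  have hcard : diagLen μ = Nat.find hex := by
    rw [diagLen, himg, Finset.card_image_of_injective _ fun a b h => (Prod.mk.inj h).1,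
      Finset.card_range]
  rw [mem, hcard]

theorem frobAlpha_add (μ : YoungDiagram) {i : ℕ} (hi : i < diagLen μ) :
    frobAlpha μ i + (i + 1) = μ.rowLen i :=
  Nat.sub_add_cancel (YoungDiagram.mem_iff_lt_rowLen.mp ((mem_diag_iff μ i).mp hi))

theorem frobBeta_add (μ : YoungDiagram) {i : ℕ} (hi : i < diagLen μ) :
    frobBeta μ i + (i + 1) = μ.colLen i :=
  Nat.sub_add_cancel (YoungDiagram.mem_iff_lt_colLen.mp ((mem_diag_iff μ i).mp hi))

end Consistency

end FermiFock

/-!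
Since `[J_{-k}, ψ_m] = ψ_{m+k}`, the operator `J_-(t)` acts on the fermions `∑_k f_k ψ_{m+k}` as
multiplication of `f` by `ξ(t, z)`, so that `e^{J_-(t)} ψ_m = (∑_k h_k(t) ψ_{m+k}) e^{J_-(t)}`.
Stripping `|n⟩ = ψ_{n-1} ⋯ ψ_a |a⟩` of one mode at a time, the coefficients of `e^{J_-(t)} |n⟩`
obey the expansion of a determinant along a column; on the Maya diagram with the modes
`n + λ_i - i` this determinant is the Jacobi–Trudi determinant `s_λ(t)`. As `J_-(t)` conserves the
charge, no other Maya diagrams occur. The state `|λ, n⟩` is such a basis state up to sign, and its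
sign is found by counting the occupied modes above each mode that is filled or emptied. Bras are
transposed kets, which turns `J_k` into `J_{-k}`, so the bra identities are the ket identities.
-/

namespace FermiFock

open PowerSeries Finset.HasAntidiagonal
open scoped PowerSeries.WithPiTopology

section FormalSums

theorem hasSum_finsum {ι M : Type*} [AddCommMonoid M] [TopologicalSpace M] {f : ι → M}
    (hf : (Function.support f).Finite) : HasSum f (∑ᶠ i, f i) := by
  rw [finsum_eq_sum _ hf]
  exact hasSum_sum_of_ne_finset_zero fun i hi => by simpa using hi

theorem pow_mul_eq_sum_antidiagonal {A : Type*} [Semiring A] {d : A} {f : ℕ → A}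
    (hf : ∀ q, d * f q = f (q + 1) + f q * d) (p : ℕ) :
    d ^ p * f 0 = ∑ ij ∈ antidiagonal p, p.choose ij.1 • (f ij.1 * d ^ ij.2) := by
  induction p with
  | zero => simp
  | succ p ih =>
    rw [Finset.sum_antidiagonal_choose_succ_nsmul fun i j => f i * d ^ j, pow_succ', mul_assoc, ih,
      Finset.mul_sum, ← Finset.sum_add_distrib]
    refine Finset.sum_congr rfl fun ij hij => ?_
    rw [← Nat.choose_symm_of_eq_add (mem_antidiagonal.mp hij).symm, mul_smul_comm, ← mul_assoc, hf,
      add_mul, mul_assoc, ← pow_succ', smul_add, add_comm]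

variable {R E ι : Type*} [CommRing R] [TopologicalSpace R] [IsTopologicalRing R]
  [AddCommGroup E] [Module R E] [TopologicalSpace E]

/-- The operator `∑ i, L i` into the space of kets, for a family of operators of which only finitely
many reach any given basis state. Kets carry the topology of coefficientwise convergence. -/
noncomputable def formalSum (L : ι → E →L[R] Ket R)
    (hL : ∀ S, {i | ∃ v, L i v S ≠ 0}.Finite) : E →L[R] Ket R where
  toFun v S := ∑ᶠ i, L i v S
  map_add' v w := by
    funext S
    have hfin (u : E) : (Function.support fun i => L i u S).Finite :=
      (hL S).subset fun i hi => ⟨u, hi⟩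
    simp only [map_add, Pi.add_apply, finsum_add_distrib (hfin v) (hfin w)]
  map_smul' c v := by
    funext S
    have hfin : (Function.support fun i => L i v S).Finite := (hL S).subset fun i hi => ⟨v, hi⟩
    simp only [map_smul, Pi.smul_apply, smul_eq_mul, RingHom.id_apply, mul_finsum' _ _ hfin]
  cont := by
    refine continuous_pi fun S => ?_
    have hsum (v : E) : ∑ᶠ i, L i v S = ∑ i ∈ (hL S).toFinset, L i v S :=
      finsum_eq_finsetSum_of_support_subset _ fun i hi => by
        simpa only [Set.Finite.coe_toFinset] using ⟨v, hi⟩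
    simp only [hsum]
    fun_prop

theorem hasSum_formalSum (L : ι → E →L[R] Ket R)
    (hL : ∀ S, {i | ∃ v, L i v S ≠ 0}.Finite) (v : E) :
    HasSum (fun i => L i v) (formalSum L hL v) :=
  Pi.hasSum.mpr fun S => hasSum_finsum ((hL S).subset fun _ hi => ⟨v, hi⟩)

end FormalSums

theorem Maya.finite_setOf_add_mem (S : Maya) (m : ℤ) : {k : ℕ | m + k ∈ S.occ}.Finite := by
  obtain ⟨-, b, -, hb⟩ := S.exists_bounds
  refine (Set.finite_Iic (b - m).toNat).subset fun k hk => ?_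
  have hkb := hb _ hk
  simp only [Set.mem_Iic]
  omega

section Fermions

variable {R : Type*} [CommRing R]

theorem psiKet_ne_zero {k : ℤ} {v : Ket R} {S : Maya} (h : psiKet k v S ≠ 0) :
    k ∈ S.occ ∧ v (S.erase k) ≠ 0 := by
  have hk : k ∈ S.occ := by
    by_contra hk
    simp [psiKet, hk] at h
  simp only [psiKet, hk, if_true] at h
  exact ⟨hk, right_ne_zero_of_mul h⟩

variable [TopologicalSpace R]

theorem hasSum_exp_subst [Algebra ℚ R] {f : R⟦X⟧} (hf : HasSubst f) :
    HasSum (fun q : ℕ => algebraMap ℚ R (q.factorial : ℚ)⁻¹ • f ^ q) ((exp R).subst f) := by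
  refine (WithPiTopology.hasSum_iff_hasSum_coeff R).mpr fun d => ?_
  rw [coeff_subst' hf]
  convert hasSum_finsum (coeff_subst_finite' hf (exp R) d) using 2 with q
  rw [coeff_exp, one_div, map_smul]

theorem hasSum_currentKet {k : ℤ} (hk : k ≠ 0) (v : Ket R) :
    HasSum (fun j => psiKet j (psiStarKet (j + k) v)) (currentKet k v) :=
  Pi.hasSum.mpr fun S => hasSum_finsum (currentKet_finite hk v S)

theorem hasSum_JMinus (t : ℕ → R) (v : Ket R) :
    HasSum (fun k : ℕ => t (k + 1) • currentKet (-((k : ℤ) + 1)) v) (JMinus t v) :=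
  Pi.hasSum.mpr fun S => hasSum_finsum (JMinus_finite t v S)

theorem hasSum_expJMinus [Algebra ℚ R] (t : ℕ → R) (v : Ket R) :
    HasSum (fun m : ℕ => algebraMap ℚ R (m.factorial : ℚ)⁻¹ • (JMinus t)^[m] v)
      (expJMinus t v) := by
  simp only [algebraMap_smul]
  exact Pi.hasSum.mpr fun S => hasSum_finsum (expJMinus_finite t v S)

variable [IsTopologicalRing R]

/-- The creation operator `ψ_k` as a continuous linear map. -/
noncomputable def psiCLM (k : ℤ) : Ket R →L[R] Ket R where
  toFun := psiKet k
  map_add' v w := by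
    funext S
    by_cases hk : k ∈ S.occ <;> simp [psiKet, hk, mul_add]
  map_smul' c v := by
    funext S
    by_cases hk : k ∈ S.occ <;> simp [psiKet, hk, mul_left_comm]
  cont := by
    refine continuous_pi fun S => ?_
    by_cases hk : k ∈ S.occ <;> simp only [psiKet, hk, if_true, if_false] <;> fun_prop

/-- The annihilation operator `ψ*_k` as a continuous linear map. -/
noncomputable def psiStarCLM (k : ℤ) : Ket R →L[R] Ket R where
  toFun := psiStarKet k
  map_add' v w := by
    funext S
    by_cases hk : k ∈ S.occ <;> simp [psiStarKet, hk, mul_add]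
  map_smul' c v := by
    funext S
    by_cases hk : k ∈ S.occ <;> simp [psiStarKet, hk, mul_left_comm]
  cont := by
    refine continuous_pi fun S => ?_
    by_cases hk : k ∈ S.occ <;> simp only [psiStarKet, hk, if_true, if_false] <;> fun_prop

end Fermions

section Commutators

variable {R : Type*} [CommRing R]

theorem psiKet_psiStarKet_psiKet (i j m : ℤ) (v : Ket R) :
    psiKet j (psiStarKet i (psiKet m v)) =
      (if m = i then psiKet j v else 0) + psiKet m (psiKet j (psiStarKet i v)) := by
  let _ : TopologicalSpace R := ⊥
  have : DiscreteTopology R := ⟨rfl⟩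
  have hstar : psiStarKet i (psiKet m v) = (if m = i then v else 0) - psiKet m (psiStarKet i v) :=
    eq_sub_of_add_eq' (psiKet_psiStarKet_anticomm m i v)
  have hpsi : psiKet m (psiKet j (psiStarKet i v)) = -psiKet j (psiKet m (psiStarKet i v)) :=
    eq_neg_of_add_eq_zero_left (psiKet_anticomm m j _)
  rw [hstar, hpsi, ← sub_eq_add_neg]
  refine (map_sub (psiCLM j) _ _).trans (congrArg₂ _ ?_ rfl)
  exact (apply_ite (psiCLM j) _ _ _).trans (by rw [map_zero]; rfl)

theorem currentKet_psiKet {k : ℤ} (hk : k ≠ 0) (m : ℤ) (v : Ket R) :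
    currentKet k (psiKet m v) = psiKet (m - k) v + psiKet m (currentKet k v) := by
  let _ : TopologicalSpace R := ⊥
  have : DiscreteTopology R := ⟨rfl⟩
  refine (hasSum_currentKet hk _).unique ?_
  simp only [psiKet_psiStarKet_psiKet]
  refine HasSum.add ?_ ((psiCLM m).hasSum (hasSum_currentKet hk v))
  convert hasSum_single (m - k) fun j hj => ?_ using 1
  · rw [if_pos (by ring)]
  · rw [if_neg (by omega)]

end Commutators

section FermionSeries

variable {R : Type*} [CommRing R] [TopologicalSpace R] [IsTopologicalRing R]

/-- The current `J_k` as a continuous linear map. -/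
noncomputable def currentCLM (k : ℤ) (hk : k ≠ 0) : Ket R →L[R] Ket R :=
  formalSum (fun j => psiCLM j ∘L psiStarCLM (j + k)) fun S => by
    obtain ⟨a, b, ha, hb⟩ := S.exists_bounds
    refine (Set.finite_Icc (a - k) b).subset fun j ⟨v, hv⟩ => ?_
    obtain ⟨hj, hjk, -⟩ := current_term_ne_zero (by omega) hv
    have haj : a ≤ j + k := not_lt.mp fun h => hjk (ha _ h)
    exact ⟨by omega, hb j hj⟩

/-- `J_-(t)` as a continuous linear map. -/
noncomputable def JMinusCLM (t : ℕ → R) : Ket R →L[R] Ket R :=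
  formalSum (fun k : ℕ => t (k + 1) • currentCLM (-((k : ℤ) + 1)) (by omega)) fun S => by
    obtain ⟨a, b, ha, hb⟩ := S.exists_bounds
    refine (Set.finite_Iic (b - a).toNat).subset fun k ⟨v, hv⟩ => ?_
    obtain ⟨i, j, hij, hj, hi, -⟩ := currentKet_ne_zero (right_ne_zero_of_mul hv)
    have hjb := hb j hj
    have hai : a ≤ i := not_lt.mp fun h => hi (ha _ h)
    simp only [Set.mem_Iic]
    omega

theorem JMinusCLM_pow_apply (t : ℕ → R) (m : ℕ) (v : Ket R) :
    (JMinusCLM t ^ m) v = (JMinus t)^[m] v :=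
  congrFun (FunLike.coe_pow_eq_iterate (JMinusCLM t) m) v

/-- The fermion `∑ k, f_k ψ_{m+k}` with coefficients those of a power series `f`. -/
noncomputable def psiSeries (m : ℤ) (f : R⟦X⟧) : Ket R →L[R] Ket R :=
  formalSum (fun k : ℕ => coeff k f • psiCLM (m + k)) fun S =>
    (S.finite_setOf_add_mem m).subset fun _ ⟨_, hv⟩ => (psiKet_ne_zero (right_ne_zero_of_mul hv)).1

theorem hasSum_psiSeries (m : ℤ) (f : R⟦X⟧) (v : Ket R) :
    HasSum (fun k : ℕ => coeff k f • psiKet (m + k) v) (psiSeries m f v) := by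
  rw [psiSeries]
  exact hasSum_formalSum _ _ v

/-- The ket `psiSeries m f v` as a continuous linear function of the power series `f`. -/
noncomputable def psiSeriesFlip (m : ℤ) (v : Ket R) : R⟦X⟧ →L[R] Ket R :=
  formalSum
    (fun k : ℕ => ContinuousLinearMap.smulRight
      ⟨coeff k, WithPiTopology.continuous_coeff R k⟩ (psiCLM (m + k) v))
    fun S => (S.finite_setOf_add_mem m).subset fun _ ⟨_, hf⟩ =>
      (psiKet_ne_zero (right_ne_zero_of_mul hf)).1

theorem psiSeriesFlip_apply (m : ℤ) (v : Ket R) (f : R⟦X⟧) :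
    psiSeriesFlip m v f = psiSeries m f v :=
  rfl

theorem psiSeries_ne_zero {m : ℤ} {f : R⟦X⟧} {v : Ket R} {S : Maya} (h : psiSeries m f v S ≠ 0) :
    ∃ k : ℕ, coeff k f ≠ 0 ∧ m + k ∈ S.occ ∧ v (S.erase (m + k)) ≠ 0 := by
  obtain ⟨k, hk⟩ : ∃ k : ℕ, coeff k f * psiKet (m + k) v S ≠ 0 := by
    by_contra! h0
    exact h ((finsum_congr h0).trans finsum_zero)
  exact ⟨k, left_ne_zero_of_mul hk, psiKet_ne_zero (right_ne_zero_of_mul hk)⟩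

theorem summable_psiSeries_JMinus_iterate (t : ℕ → R) (m : ℤ) (f : R⟦X⟧) (c : ℕ → R) (v : Ket R) :
    Summable fun ij : ℕ × ℕ =>
      psiSeries m (f * (c ij.1 • xi t ^ ij.1)) (c ij.2 • (JMinus t)^[ij.2] v) := by
  refine Pi.summable.mpr fun S => summable_of_hasFiniteSupport ?_
  refine ((S.finite_setOf_add_mem m).biUnion fun k _ =>
    Set.finite_Iic (k, (S.erase (m + k)).energy.toNat)).subset fun ⟨i, j⟩ hij => ?_
  obtain ⟨k, hcoeff, hk, hv⟩ := psiSeries_ne_zero hij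
  have hik : i ≤ k := by
    by_contra! hki
    have hX : X ∣ xi t := X_dvd_iff.mpr (by simp [xi])
    have hdvd : X ^ i ∣ f * (c i • xi t ^ i) := by
      rw [smul_eq_C_mul]
      exact ((pow_dvd_pow_of_dvd hX i).mul_left _).mul_left _
    exact hcoeff (X_pow_dvd_iff.mp hdvd k hki)
  have hj := JMinus_iterate_ne_zero t v j _ (right_ne_zero_of_mul hv)
  exact Set.mem_biUnion hk ⟨hik, by omega⟩

variable [T2Space R]

theorem psiSeries_monomial (m : ℤ) (k : ℕ) (c : R) (v : Ket R) :
    psiSeries m (monomial k c) v = c • psiKet (m + k) v := by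
  refine (hasSum_psiSeries m _ v).unique ?_
  convert hasSum_single k fun j hj => ?_ using 1
  · rw [coeff_monomial_same]
  · rw [coeff_monomial, if_neg hj, zero_smul]

theorem psiSeries_monomial_mul (m : ℤ) (k : ℕ) (c : R) (f : R⟦X⟧) (v : Ket R) :
    psiSeries m (monomial k c * f) v = c • psiSeries (m + k) f v := by
  have hsum := (hasSum_of_monomials_self f).mul_left (monomial k c)
  refine ((psiSeriesFlip m v).hasSum hsum).unique ?_
  convert (hasSum_psiSeries (m + k) f v).const_smul c using 2 with l
  rw [monomial_mul_monomial, psiSeriesFlip_apply, psiSeries_monomial, mul_smul, Nat.cast_add,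
    add_assoc]

theorem JMinus_psiKet (t : ℕ → R) (m : ℤ) (v : Ket R) :
    JMinus t (psiKet m v) = psiSeries m (xi t) v + psiKet m (JMinus t v) := by
  refine (hasSum_JMinus t _).unique ?_
  have hxi : HasSum (fun k : ℕ => t (k + 1) • psiKet (m + (k + 1)) v) (psiSeries m (xi t) v) := by
    simpa [xi] using (hasSum_nat_add_iff' 1).mpr (hasSum_psiSeries m (xi t) v)
  convert hxi.add ((psiCLM m).hasSum (hasSum_JMinus t v)) using 2 with k
  · rw [currentKet_psiKet (by omega), sub_neg_eq_add, smul_add, map_smul]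
    rfl
  · rfl

theorem JMinus_psiSeries (t : ℕ → R) (m : ℤ) (f : R⟦X⟧) (v : Ket R) :
    JMinus t (psiSeries m f v) = psiSeries m (f * xi t) v + psiSeries m f (JMinus t v) := by
  refine ((JMinusCLM t).hasSum (hasSum_psiSeries m f v)).unique ?_
  have hxi := (psiSeriesFlip m v).hasSum ((hasSum_of_monomials_self f).mul_right (xi t))
  convert hxi.add (hasSum_psiSeries m f (JMinus t v)) using 2 with k
  · rw [map_smul, psiSeriesFlip_apply, psiSeries_monomial_mul, ← smul_add, ← JMinus_psiKet]
    rfl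
  · rfl

theorem JMinus_iterate_psiSeries (t : ℕ → R) (m : ℤ) (f : R⟦X⟧) (v : Ket R) (p : ℕ) :
    (JMinus t)^[p] (psiSeries m f v) = ∑ ij ∈ antidiagonal p,
      p.choose ij.1 • psiSeries m (f * xi t ^ ij.1) ((JMinus t)^[ij.2] v) := by
  have hcomm (q : ℕ) : JMinusCLM t * psiSeries m (f * xi t ^ q) =
      psiSeries m (f * xi t ^ (q + 1)) + psiSeries m (f * xi t ^ q) * JMinusCLM t := by
    ext1 w
    rw [pow_succ, ← mul_assoc]
    exact JMinus_psiSeries t m (f * xi t ^ q) w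
  have hpow := congrArg (· v) (pow_mul_eq_sum_antidiagonal hcomm p)
  simpa [← JMinusCLM_pow_apply] using hpow

theorem inv_factorial_smul_JMinus_iterate_psiSeries [Algebra ℚ R] (t : ℕ → R) (m : ℤ) (f : R⟦X⟧)
    (v : Ket R) (p : ℕ) :
    algebraMap ℚ R (p.factorial : ℚ)⁻¹ • (JMinus t)^[p] (psiSeries m f v) = ∑ ij ∈ antidiagonal p,
      psiSeries m (f * (algebraMap ℚ R (ij.1.factorial : ℚ)⁻¹ • xi t ^ ij.1))
        (algebraMap ℚ R (ij.2.factorial : ℚ)⁻¹ • (JMinus t)^[ij.2] v) := by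
  rw [JMinus_iterate_psiSeries, Finset.smul_sum]
  refine Finset.sum_congr rfl fun ij hij => ?_
  rw [← mem_antidiagonal.mp hij]
  have hfact : ((ij.1 + ij.2).factorial : ℚ)⁻¹ * (ij.1 + ij.2).choose ij.1 =
      (ij.2.factorial : ℚ)⁻¹ * (ij.1.factorial : ℚ)⁻¹ := by
    rw [Nat.cast_add_choose]
    field_simp
  rw [map_smul, mul_smul_comm, ← psiSeriesFlip_apply _ _ (_ • _), map_smul, psiSeriesFlip_apply,
    ← Nat.cast_smul_eq_nsmul R, smul_smul, smul_smul, ← map_natCast (algebraMap ℚ R), ← map_mul,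
    hfact, map_mul]

theorem expJMinus_psiSeries [Algebra ℚ R] (t : ℕ → R) (m : ℤ) (f : R⟦X⟧) (v : Ket R) :
    expJMinus t (psiSeries m f v) = psiSeries m (f * (exp R).subst (xi t)) (expJMinus t v) := by
  have hF := (summable_psiSeries_JMinus_iterate t m f
    (fun q => algebraMap ℚ R (q.factorial : ℚ)⁻¹) v).hasSum
  have hrow (i : ℕ) := (psiSeries m (f * (algebraMap ℚ R (i.factorial : ℚ)⁻¹ • xi t ^ i))).hasSum
    (hasSum_expJMinus t v)
  have hcol := (psiSeriesFlip m (expJMinus t v)).hasSum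
    ((hasSum_exp_subst (hasSubst_xi t)).mul_left f)
  have hdiag := (sigmaAntidiagonalEquivProd.hasSum_iff.mpr hF).sigma fun p => hasSum_fintype _
  refine ((hasSum_expJMinus t _).unique ?_).trans ((hF.prod_fiberwise hrow).unique hcol)
  convert hdiag using 2 with p
  rw [inv_factorial_smul_JMinus_iterate_psiSeries]
  exact (Finset.sum_coe_sort _ _).symm

theorem expJMinus_psiKet [Algebra ℚ R] (t : ℕ → R) (m : ℤ) (v : Ket R) :
    expJMinus t (psiKet m v) = psiSeries m ((exp R).subst (xi t)) (expJMinus t v) := by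
  have hone : psiSeries m 1 v = psiKet m v := by
    simpa using psiSeries_monomial m 0 (1 : R) v
  rw [← hone, expJMinus_psiSeries, one_mul]

end FermionSeries

section Vacua

variable {R : Type*} [CommRing R]

open Classical in
/-- The basis ket `|T⟩`. -/
noncomputable def ketOf (T : Maya) : Ket R := fun S => if S = T then 1 else 0

theorem psiKet_ketOf {k : ℤ} {T : Maya} (hk : k ∉ T.occ) :
    psiKet k (ketOf T : Ket R) = (-1 : R) ^ T.above k • ketOf (T.insert k) := by
  funext S
  by_cases hS : k ∈ S.occ
  · by_cases hT : S = T.insert k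
    · subst hT
      simp [psiKet, ketOf, Maya.mem_insert, Maya.erase_insert hk, Maya.above_insert hk]
    · have hne : S.erase k ≠ T := fun h => hT (by rw [← h, Maya.insert_erase hS])
      simp [psiKet, ketOf, hne, hT]
  · have hne : S ≠ T.insert k := fun h => hS (h ▸ Or.inl rfl)
    simp [psiKet, ketOf, hne, hS]

theorem psiStarKet_ketOf {k : ℤ} {T : Maya} (hk : k ∈ T.occ) :
    psiStarKet k (ketOf T : Ket R) = (-1 : R) ^ T.above k • ketOf (T.erase k) := by
  funext S
  by_cases hS : k ∈ S.occ
  · have hne : S ≠ T.erase k := fun h => (Maya.mem_erase.mp (h ▸ hS)).2 rfl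
    simp [psiStarKet, ketOf, hne, hS]
  · by_cases hT : S = T.erase k
    · subst hT
      simp [psiStarKet, ketOf, Maya.mem_erase, Maya.insert_erase hk, Maya.above_erase hk k]
    · have hne : S.insert k ≠ T := fun h => hT (by rw [← h, Maya.erase_insert hS])
      simp [psiStarKet, ketOf, hne, hS, hT]

theorem wordKet_append (w w' : List Fermion) (v : Ket R) :
    wordKet (w ++ w') v = wordKet w (wordKet w' v) :=
  List.foldr_append ..

/-- The Maya diagram of the shifted vacuum `|n⟩`: exactly the modes below `n` are occupied. -/
def Maya.vac (n : ℤ) : Maya where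
  occ := Set.Iio n
  finite_particles := (Set.finite_Icc 0 n).subset fun _ hx => ⟨hx.2, (Set.mem_Iio.mp hx.1).le⟩
  finite_holes := (Set.finite_Icc n 0).subset fun _ hx => ⟨not_lt.mp hx.1, hx.2.le⟩

theorem Maya.mem_vac {n x : ℤ} : x ∈ (Maya.vac n).occ ↔ x < n := Iff.rfl

theorem Maya.vac_insert (n : ℤ) : (Maya.vac n).insert n = Maya.vac (n + 1) := by
  ext x
  simp only [Maya.mem_insert, Maya.mem_vac]
  omega

theorem Maya.vac_erase (n : ℤ) : (Maya.vac (n + 1)).erase n = Maya.vac n := by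
  ext x
  simp only [Maya.mem_erase, Maya.mem_vac]
  omega

theorem Maya.above_vac (n k : ℤ) : (Maya.vac n).above k = (n - 1 - k).toNat := by
  have hIoo : {s : ℤ | s ∈ (Maya.vac n).occ ∧ k < s} = ↑(Finset.Ioo k n) := by
    ext x
    simp only [Maya.mem_vac, Finset.coe_Ioo, Set.mem_Ioo, Set.mem_ofPred_eq, and_comm]
  rw [Maya.above, hIoo, Set.ncard_coe_finset, Int.card_Ioo, sub_right_comm]

theorem psiKet_vac (n : ℤ) : psiKet n (ketOf (Maya.vac n) : Ket R) = ketOf (Maya.vac (n + 1)) := by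
  rw [psiKet_ketOf (by simp [Maya.mem_vac]), Maya.above_vac, Maya.vac_insert]
  simp

theorem psiStarKet_vac (n : ℤ) :
    psiStarKet n (ketOf (Maya.vac (n + 1)) : Ket R) = ketOf (Maya.vac n) := by
  rw [psiStarKet_ketOf (by simp [Maya.mem_vac]), Maya.above_vac, Maya.vac_erase]
  simp

theorem wordKet_psi_ketZero (m : ℕ) :
    wordKet ((List.range m).map fun i : ℕ => Fermion.psi i).reverse ketZero =
      (ketOf (Maya.vac m) : Ket R) := by
  induction m with
  | zero => rfl
  | succ m ih =>
    rw [List.range_succ, List.map_append, List.reverse_append, wordKet_append, ih, Nat.cast_succ]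
    exact psiKet_vac (m : ℤ)

theorem wordKet_psiStar_ketZero (m : ℕ) :
    wordKet ((List.range m).map fun i : ℕ => Fermion.psiStar (-i - 1)).reverse ketZero =
      (ketOf (Maya.vac (-m)) : Ket R) := by
  induction m with
  | zero => rfl
  | succ m ih =>
    have hvac := psiStarKet_vac (R := R) (-m - 1)
    rw [sub_add_cancel] at hvac
    rw [List.range_succ, List.map_append, List.reverse_append, wordKet_append, ih, Nat.cast_succ,
      neg_add']
    exact hvac

theorem ketVac_eq (n : ℤ) : (ketVac n : Ket R) = ketOf (Maya.vac n) := by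
  -- `ketVac` maps over a list of integers, to which `List.range` is coerced by a monadic lift.
  have hcast (l : List ℕ) : (do let a ← l; pure (a : ℤ)) = l.map Nat.cast := by
    simp [List.map_eq_flatMap]
  rw [ketVac, hcast, hcast, List.map_map, List.map_map]
  split_ifs with hn
  · exact (wordKet_psi_ketZero _).trans (by rw [Int.toNat_of_nonneg hn])
  · exact (wordKet_psiStar_ketZero _).trans (by rw [Int.toNat_of_nonneg (by omega), neg_neg])

theorem JMinus_apply_vac (t : ℕ → R) (v : Ket R) (n : ℤ) : JMinus t v (Maya.vac n) = 0 := by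
  refine (finsum_congr fun k => ?_).trans finsum_zero
  by_contra h
  obtain ⟨i, j, hij, hj, hi, -⟩ := currentKet_ne_zero (right_ne_zero_of_mul h)
  rw [Maya.mem_vac] at hi hj
  omega

theorem expJMinus_apply_vac [Algebra ℚ R] (t : ℕ → R) (v : Ket R) (n : ℤ) :
    expJMinus t v (Maya.vac n) = v (Maya.vac n) := by
  rw [expJMinus, finsum_eq_single _ 0 fun m hm => ?_]
  · simp
  · obtain ⟨m, rfl⟩ := Nat.exists_eq_succ_of_ne_zero hm
    rw [Function.iterate_succ_apply', JMinus_apply_vac, smul_zero]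

end Vacua

section Determinant

theorem Maya.above_of_strictAnti {ι : Type*} [LinearOrder ι] {q : ι → ℤ} (hq : StrictAnti q)
    {S : Maya} {i : ι} (hS : ∀ x, q i < x → (x ∈ S.occ ↔ x ∈ Set.range q)) :
    S.above (q i) = (Set.Iio i).ncard := by
  rw [Maya.above, ← Set.ncard_image_of_injective _ hq.injective]
  congr 1
  ext x
  constructor
  · rintro ⟨hx, hlt⟩
    obtain ⟨j, rfl⟩ := (hS x hlt).mp hx
    exact ⟨j, hq.lt_iff_gt.mp hlt, rfl⟩
  · rintro ⟨j, hj, rfl⟩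
    exact ⟨(hS _ (hq hj)).mpr ⟨j, rfl⟩, hq hj⟩

/-- The Maya diagram in which, besides all modes below `a`, the modes `s i` are occupied. -/
def Maya.ofTuple (a : ℤ) {N : ℕ} (s : Fin N → ℤ) : Maya where
  occ := Set.Iio a ∪ Set.range s
  finite_particles := ((Set.finite_Icc 0 a).union (Set.finite_range s)).subset <| by
    rintro x ⟨hx | hx, h0⟩
    · exact Or.inl ⟨h0, (Set.mem_Iio.mp hx).le⟩
    · exact Or.inr hx
  finite_holes := (Set.finite_Icc a 0).subset fun _ hx =>
    ⟨not_lt.mp fun h => hx.1 (Or.inl h), hx.2.le⟩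

theorem Maya.mem_ofTuple {a x : ℤ} {N : ℕ} {s : Fin N → ℤ} :
    x ∈ (Maya.ofTuple a s).occ ↔ x < a ∨ x ∈ Set.range s :=
  Iff.rfl

theorem Maya.above_ofTuple {a : ℤ} {N : ℕ} {s : Fin N → ℤ} (hs : StrictAnti s) {i : Fin N}
    (hi : a ≤ s i) : (Maya.ofTuple a s).above (s i) = i := by
  rw [Maya.above_of_strictAnti hs fun x hx => ?_, ← Finset.coe_Iio, Set.ncard_coe_finset,
    Fin.card_Iio]
  exact or_iff_right (hi.trans_lt hx).not_gt

theorem Maya.erase_ofTuple {a : ℤ} {N : ℕ} {s : Fin (N + 1) → ℤ} (hs : Function.Injective s)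
    {i : Fin (N + 1)} (hi : a ≤ s i) :
    (Maya.ofTuple a s).erase (s i) = Maya.ofTuple a (s ∘ i.succAbove) := by
  ext x
  simp only [Maya.mem_erase, Maya.mem_ofTuple, Set.range_comp, Fin.range_succAbove,
    Set.image_compl_eq_range_sdiff_image hs, Set.image_singleton, Set.mem_sdiff,
    Set.mem_singleton_iff]
  have hx : x < a → x ≠ s i := fun h => (h.trans_le hi).ne
  tauto

variable {R : Type*} [CommRing R] [Algebra ℚ R]

theorem hasSum_psiSeries_exp [TopologicalSpace R] [IsTopologicalRing R] (t : ℕ → R) (m : ℤ)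
    (v : Ket R) (S : Maya) :
    HasSum (fun x : ℤ => hPoly t (x - m) * psiKet x v S)
      (psiSeries m ((exp R).subst (xi t)) v S) := by
  have hinj : Function.Injective fun k : ℕ => m + k := fun k l h => by simpa using h
  refine (hinj.hasSum_iff fun x hx => ?_).mp ?_
  · rw [hPoly, if_neg, zero_mul]
    exact fun h => hx ⟨(x - m).toNat, by simp only; omega⟩
  · convert Pi.hasSum.mp (hasSum_psiSeries m _ v) S using 2 with k
    simp [hPoly]

theorem psiSeries_exp_apply_ofTuple [TopologicalSpace R] [IsTopologicalRing R] [T2Space R]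
    (t : ℕ → R) {m a : ℤ} (ham : a ≤ m) (v : Ket R) {N : ℕ} {s : Fin (N + 1) → ℤ}
    (hs : StrictAnti s) (hsa : ∀ i, a ≤ s i) :
    psiSeries m ((exp R).subst (xi t)) v (Maya.ofTuple a s) =
      ∑ i : Fin (N + 1),
        (-1) ^ (i : ℕ) * hPoly t (s i - m) * v (Maya.ofTuple a (s ∘ i.succAbove)) := by
  refine ((hs.injective.hasSum_iff fun x hx => ?_).mpr (hasSum_psiSeries_exp t m v _)).unique ?_
  · by_cases hxm : x < m
    · rw [hPoly, if_neg (by omega), zero_mul]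
    · rw [psiKet, if_neg, mul_zero]
      exact fun h => h.elim (fun hxa => hxm (lt_of_lt_of_le hxa ham)) hx
  · convert hasSum_fintype _ using 2 with i
    have hi : s i ∈ (Maya.ofTuple a s).occ := Or.inr ⟨i, rfl⟩
    rw [Function.comp_apply, psiKet, if_pos hi, Maya.above_ofTuple hs (hsa i),
      Maya.erase_ofTuple hs.injective (hsa i)]
    ring

theorem expJMinus_vac_ofTuple (t : ℕ → R) (a : ℤ) {N : ℕ} {s : Fin N → ℤ} (hs : StrictAnti s)
    (hsa : ∀ i, a ≤ s i) :
    expJMinus t (ketOf (Maya.vac (a + N))) (Maya.ofTuple a s) =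
      (Matrix.of fun i j : Fin N => hPoly t (s i - (a + N) + 1 + (j : ℕ))).det := by
  let _ : TopologicalSpace R := ⊥
  have : DiscreteTopology R := ⟨rfl⟩
  induction N with
  | zero =>
    have hvac : Maya.ofTuple a s = Maya.vac (a + (0 : ℕ)) := by
      ext x
      simp [Maya.mem_ofTuple, Maya.mem_vac]
    rw [hvac, expJMinus_apply_vac, Matrix.det_isEmpty, ketOf, if_pos rfl]
  | succ N ih =>
    rw [Nat.cast_succ, ← add_assoc, ← psiKet_vac, expJMinus_psiKet,
      psiSeries_exp_apply_ofTuple t (by omega) _ hs hsa, Matrix.det_succ_column_zero]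
    refine Finset.sum_congr rfl fun i _ => ?_
    rw [ih (hs.comp_strictMono i.strictMono_succAbove) fun j => hsa _]
    congr 2
    · simp [sub_add_eq_sub_sub]
    · ext j k
      simp only [Matrix.of_apply, Matrix.submatrix_apply, Function.comp_apply, Fin.val_succ]
      congr 1
      push_cast
      ring

end Determinant

section Partitions

theorem rowLen_sub_strictAnti (μ : YoungDiagram) (n : ℤ) :
    StrictAnti fun i : ℕ => n + μ.rowLen i - i - 1 := fun i j hij => by
  have hrow := μ.rowLen_anti i j hij.le
  simp only
  omega

theorem rowLen_eq_zero {μ : YoungDiagram} {i : ℕ} (hi : μ.colLen 0 ≤ i) : μ.rowLen i = 0 := by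
  by_contra h
  exact hi.not_gt <| YoungDiagram.mem_iff_lt_colLen.mp <|
    YoungDiagram.mem_iff_lt_rowLen.mpr (Nat.pos_of_ne_zero h)

/-- The Maya diagram of charge `n` that belongs to `μ`, with occupied modes `n + μ_i - i`
for `i = 1, 2, …`. -/
def Maya.ofYoung (μ : YoungDiagram) (n : ℤ) : Maya where
  occ := Set.range fun i : ℕ => n + μ.rowLen i - i - 1
  finite_particles := by
    refine ((Set.finite_Iic (n + μ.rowLen 0).toNat).image fun i => n + μ.rowLen i - i - 1).subset ?_
    rintro _ ⟨⟨i, rfl⟩, h⟩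
    refine ⟨i, ?_, rfl⟩
    have hrow := μ.rowLen_anti 0 i (Nat.zero_le _)
    simp only [Set.mem_Iic] at h ⊢
    omega
  finite_holes := by
    refine (Set.finite_Icc (n - μ.colLen 0) 0).subset fun x ⟨hx, h0⟩ => ⟨?_, h0.le⟩
    by_contra h
    refine hx ⟨(n - 1 - x).toNat, ?_⟩
    simp only [rowLen_eq_zero (μ := μ) (i := (n - 1 - x).toNat) (by omega)]
    omega

theorem Maya.ofYoung_injective (n : ℤ) : Function.Injective fun μ => Maya.ofYoung μ n := by
  intro μ ν h
  have hrows := (StrictMono.range_inj (rowLen_sub_strictAnti μ n).dual_right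
    (rowLen_sub_strictAnti ν n).dual_right).mp (congrArg Maya.occ h)
  ext ⟨i, j⟩
  have hi : n + μ.rowLen i - i - 1 = n + ν.rowLen i - i - 1 := congrFun hrows i
  rw [YoungDiagram.mem_cells, YoungDiagram.mem_cells, YoungDiagram.mem_iff_lt_rowLen,
    YoungDiagram.mem_iff_lt_rowLen]
  omega

theorem Maya.ofYoung_eq_ofTuple (μ : YoungDiagram) (n : ℤ) :
    Maya.ofYoung μ n = Maya.ofTuple (n - μ.colLen 0) fun i : Fin (μ.colLen 0) =>
      n + μ.rowLen i - (i : ℕ) - 1 := by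
  ext x
  rw [Maya.mem_ofTuple]
  constructor
  · rintro ⟨i, rfl⟩
    by_cases hi : i < μ.colLen 0
    · exact Or.inr ⟨⟨i, hi⟩, rfl⟩
    · left
      simp only [rowLen_eq_zero (not_lt.mp hi)]
      omega
  · rintro (h | ⟨i, rfl⟩)
    · refine ⟨(n - 1 - x).toNat, ?_⟩
      simp only [rowLen_eq_zero (μ := μ) (i := (n - 1 - x).toNat) (by omega)]
      omega
    · exact ⟨i, rfl⟩

theorem exists_rowLen_eq {r : ℕ → ℕ} (hr : Antitone r) {N : ℕ} (hN : r N = 0) :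
    ∃ μ : YoungDiagram, ∀ i, μ.rowLen i = r i := by
  have hsorted : (List.ofFn fun i : Fin N => r i).SortedGE :=
    List.sortedGE_ofFn_iff.mpr fun i j hij => hr hij
  refine ⟨YoungDiagram.ofRowLens _ hsorted, fun i => eq_of_forall_lt_iff fun j => ?_⟩
  rw [← YoungDiagram.mem_iff_lt_rowLen, YoungDiagram.mem_ofRowLens]
  simp only [List.length_ofFn, List.getElem_ofFn, exists_prop, and_iff_right_iff_imp]
  intro hj
  by_contra hi
  have hle := hr (not_lt.mp hi)
  omega

theorem Maya.above_sub_one {S : Maya} {k : ℤ} (hk : k ∈ S.occ) :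
    S.above (k - 1) = S.above k + 1 := by
  rw [Maya.above, Maya.above, ← Set.ncard_insert_of_notMem (a := k) (fun h => lt_irrefl k h.2)
    (S.finite_above k)]
  congr 1
  ext x
  simp only [Set.mem_insert_iff, Set.mem_ofPred_eq]
  constructor
  · rintro ⟨hx, hlt⟩
    rcases (Int.sub_one_lt_iff.mp hlt).eq_or_lt with rfl | h
    · exact Or.inl rfl
    · exact Or.inr ⟨hx, h⟩
  · rintro (rfl | ⟨hx, h⟩)
    · exact ⟨hk, by omega⟩
    · exact ⟨hx, by omega⟩

theorem Maya.above_sub_add_one {S : Maya} {a : ℤ} (ha : ∀ k < a, k ∈ S.occ) (j : ℕ) :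
    S.above (a - (j + 1)) = S.above (a - 1) + j := by
  induction j with
  | zero => simp
  | succ j ih =>
    rw [← add_assoc, ← ih, ← Maya.above_sub_one (ha _ (by omega))]
    congr 1
    push_cast
    ring

theorem Maya.exists_strictAnti_range_eq (S : Maya) :
    ∃ q : ℕ → ℤ, StrictAnti q ∧ Set.range q = S.occ := by
  classical
  obtain ⟨a, b, ha, hb⟩ := S.exists_bounds
  have hinf : (Set.ofPred fun k : ℕ => b - k ∈ S.occ).Infinite :=
    (Set.Ioi_infinite (b - a).toNat).mono fun k hk => ha _ (by
      rw [Set.mem_Ioi] at hk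
      omega)
  refine ⟨fun i => b - Nat.nth (fun k => b - k ∈ S.occ) i, fun i j hij => ?_, ?_⟩
  · have hlt := Nat.nth_strictMono hinf hij
    simp only
    omega
  · refine Set.Subset.antisymm ?_ fun x hx => ?_
    · rintro _ ⟨i, rfl⟩
      exact Nat.nth_mem_of_infinite hinf i
    · have hxb : b - (b - x).toNat = x := by
        have := hb x hx
        omega
      obtain ⟨i, hi⟩ : (b - x).toNat ∈ Set.range (Nat.nth fun k : ℕ => b - k ∈ S.occ) := by
        rw [Nat.range_nth_of_infinite hinf]
        rwa [Set.mem_ofPred_eq, hxb]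
      exact ⟨i, by simp only [hi, hxb]⟩

theorem Maya.exists_eq_ofYoung {S : Maya} {a : ℤ} (ha : ∀ k < a, k ∈ S.occ) :
    ∃ μ : YoungDiagram, S = Maya.ofYoung μ (a + S.above (a - 1)) := by
  obtain ⟨q, hq, hS⟩ := S.exists_strictAnti_range_eq
  set N := S.above (a - 1) with hN
  have habove (i : ℕ) : S.above (q i) = i := by
    rw [Maya.above_of_strictAnti hq fun x _ => by rw [hS], ← Finset.coe_Iio, Set.ncard_coe_finset,
      Nat.card_Iio]
  have htail (j : ℕ) : q (N + j) = a - (j + 1) := by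
    obtain ⟨i, hi⟩ : a - (j + 1) ∈ Set.range q := hS ▸ ha _ (by omega)
    rw [← hi, hN, ← Maya.above_sub_add_one ha, ← hi, habove]
  have hanti : Antitone fun i : ℕ => q i + i + 1 - (a + N) := antitone_nat_of_succ_le fun i => by
    have hlt := hq (Nat.lt_add_one i)
    push_cast
    omega
  have hnonneg (i : ℕ) : 0 ≤ q i + i + 1 - (a + N) := by
    refine le_trans ?_ (hanti (Nat.le_add_left i N))
    simp only [htail]
    push_cast
    omega
  have hN0 : q N + N + 1 - (a + N) = 0 := by
    rw [← Nat.add_zero N, htail 0]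
    push_cast
    ring
  obtain ⟨μ, hμ⟩ := exists_rowLen_eq (fun i j hij => Int.toNat_le_toNat (hanti hij))
    (Int.toNat_eq_zero.mpr hN0.le)
  refine ⟨μ, Maya.ext (hS.symm.trans (congrArg Set.range (funext fun i => ?_)))⟩
  rw [hμ, Int.toNat_of_nonneg (hnonneg i)]
  ring

variable {R : Type*} [CommRing R]

theorem add_above_eq_of_JMinus_iterate_ne_zero (t : ℕ → R) {n a : ℤ} {m : ℕ} {S : Maya}
    (ha : ∀ k < a, k ∈ S.occ) (h : (JMinus t)^[m] (ketOf (Maya.vac n)) S ≠ 0) :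
    a + S.above (a - 1) = n := by
  induction m generalizing S with
  | zero =>
    obtain rfl : S = Maya.vac n := by
      by_contra hS
      exact h (if_neg hS)
    have han : a - 1 < n := ha (a - 1) (by omega)
    rw [Maya.above_vac]
    omega
  | succ m ih =>
    rw [Function.iterate_succ_apply'] at h
    obtain ⟨k, hk⟩ : ∃ k : ℕ, t (k + 1) *
        currentKet (-((k : ℤ) + 1)) ((JMinus t)^[m] (ketOf (Maya.vac n))) S ≠ 0 := by
      by_contra! h0
      exact h ((finsum_congr h0).trans finsum_zero)
    obtain ⟨i, j, hij, hj, hi, hv⟩ := currentKet_ne_zero (right_ne_zero_of_mul hk)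
    have hai : a ≤ i := not_lt.mp fun hlt => hi (ha i hlt)
    have hiS : i ∉ (S.erase j).occ := fun hi' => hi hi'.1
    rw [Maya.above_erase hj, if_pos (by omega), ← ih (fun x hx => ?_) hv, Maya.above_insert hiS,
      if_pos (by omega)]
    exact Or.inr ⟨ha x hx, by simp only [Set.mem_singleton_iff]; omega⟩

variable [Algebra ℚ R]

theorem mem_range_ofYoung_of_expJMinus_ne_zero (t : ℕ → R) {n : ℤ} {S : Maya}
    (h : expJMinus t (ketOf (Maya.vac n)) S ≠ 0) : S ∈ Set.range fun μ => Maya.ofYoung μ n := by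
  obtain ⟨m, hm⟩ : ∃ m : ℕ,
      (m.factorial : ℚ)⁻¹ • (JMinus t)^[m] (ketOf (Maya.vac n)) S ≠ 0 := by
    by_contra! h0
    exact h ((finsum_congr h0).trans finsum_zero)
  obtain ⟨a, -, ha, -⟩ := S.exists_bounds
  obtain ⟨μ, hμ⟩ := Maya.exists_eq_ofYoung ha
  rw [add_above_eq_of_JMinus_iterate_ne_zero t ha fun h0 => hm (by rw [h0, smul_zero])] at hμ
  exact ⟨μ, hμ.symm⟩

theorem expJMinus_vac_ofYoung (t : ℕ → R) (μ : YoungDiagram) (n : ℤ) :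
    expJMinus t (ketOf (Maya.vac n)) (Maya.ofYoung μ n) = schur μ t := by
  have hs : StrictAnti fun i : Fin (μ.colLen 0) => n + μ.rowLen i - (i : ℕ) - 1 :=
    fun i j hij => rowLen_sub_strictAnti μ n hij
  rw [Maya.ofYoung_eq_ofTuple, congrArg Maya.vac (sub_add_cancel n (μ.colLen 0 : ℤ)).symm,
    expJMinus_vac_ofTuple t _ hs fun i => by omega, schur]
  congr 2
  ext i j
  exact congrArg (hPoly t) (by ring)

end Partitions

section FrobeniusCoordinates

theorem rowLen_sub_ne_colLen_sub (μ : YoungDiagram) (i j : ℕ) :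
    (i : ℤ) - μ.rowLen i ≠ μ.colLen j - j - 1 := by
  have hcol := YoungDiagram.mem_iff_lt_colLen (μ := μ) (i := i) (j := j)
  rw [YoungDiagram.mem_iff_lt_rowLen] at hcol
  omega

theorem exists_sub_rowLen_or_colLen_sub (μ : YoungDiagram) (x : ℕ) :
    (∃ i : ℕ, (x : ℤ) = i - μ.rowLen i) ∨
      ∃ j : ℕ, j < diagLen μ ∧ (x : ℤ) = μ.colLen j - j - 1 := by
  classical
  have hex : ∃ i : ℕ, (x : ℤ) ≤ i - μ.rowLen i := by
    have hrow := μ.rowLen_anti 0 (x + μ.rowLen 0) (Nat.zero_le _)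
    exact ⟨x + μ.rowLen 0, by omega⟩
  -- If the first `i` with `x ≤ i - μ_i` does not attain equality, column `i - 1 - x` ends in row
  -- `i - 1`.
  obtain ⟨i, hi, hmin⟩ : ∃ i : ℕ, (x : ℤ) ≤ i - μ.rowLen i ∧
      ∀ k < i, ¬ (x : ℤ) ≤ k - μ.rowLen k :=
    ⟨Nat.find hex, Nat.find_spec hex, fun _ => Nat.find_min hex⟩
  rcases hi.eq_or_lt with heq | hlt
  · exact Or.inl ⟨i, heq⟩
  · have hpred := hmin (i - 1) (by omega)
    have hmem : (i - 1, i - 1 - x) ∈ μ := YoungDiagram.mem_iff_lt_rowLen.mpr (by omega)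
    have hnotMem : ¬ (i, i - 1 - x) ∈ μ := by
      rw [YoungDiagram.mem_iff_lt_rowLen]
      omega
    have hcol := YoungDiagram.mem_iff_lt_colLen.mp hmem
    rw [YoungDiagram.mem_iff_lt_colLen] at hnotMem
    have hdiag : i - 1 - x < diagLen μ :=
      (mem_diag_iff _ _).mpr (μ.up_left_mem (by omega) le_rfl hmem)
    exact Or.inr ⟨i - 1 - x, hdiag, by omega⟩

theorem diagLen_le_iff_rowLen_le (μ : YoungDiagram) (i : ℕ) : diagLen μ ≤ i ↔ μ.rowLen i ≤ i := by
  rw [← not_lt, mem_diag_iff, YoungDiagram.mem_iff_lt_rowLen, not_lt]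

theorem frobAlpha_lt_frobAlpha {μ : YoungDiagram} {i j : ℕ} (hij : i < j) (hj : j < diagLen μ) :
    frobAlpha μ j < frobAlpha μ i := by
  have hi := frobAlpha_add μ (hij.trans hj)
  have hj := frobAlpha_add μ hj
  have hrow := μ.rowLen_anti i j hij.le
  omega

theorem frobBeta_lt_frobBeta {μ : YoungDiagram} {i j : ℕ} (hij : i < j) (hj : j < diagLen μ) :
    frobBeta μ j < frobBeta μ i := by
  have hi := frobBeta_add μ (hij.trans hj)
  have hj := frobBeta_add μ hj
  have hcol := μ.colLen_anti i j hij.le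
  omega

theorem Maya.mem_ofYoung_iff_frob {μ : YoungDiagram} {n x : ℤ} :
    x ∈ (Maya.ofYoung μ n).occ ↔
      (x < n ∨ ∃ i < diagLen μ, x = n + frobAlpha μ i) ∧
        ∀ i < diagLen μ, x ≠ n - frobBeta μ i - 1 := by
  constructor
  · rintro ⟨i, rfl⟩
    refine ⟨?_, fun j hj => ?_⟩
    · rcases lt_or_ge i (diagLen μ) with hi | hi
      · have hα := frobAlpha_add μ hi
        exact Or.inr ⟨i, hi, by simp only; omega⟩
      · have hrow := (diagLen_le_iff_rowLen_le μ i).mp hi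
        exact Or.inl (by simp only; omega)
    · have hβ := frobBeta_add μ hj
      have hne := rowLen_sub_ne_colLen_sub μ i j
      simp only
      omega
  · rintro ⟨hx | ⟨i, hi, rfl⟩, hβ⟩
    · rcases exists_sub_rowLen_or_colLen_sub μ (n - 1 - x).toNat with ⟨i, hi⟩ | ⟨j, hj, hxj⟩
      · exact ⟨i, by simp only; omega⟩
      · have hβj := frobBeta_add μ hj
        exact absurd (by omega) (hβ j hj)
    · have hα := frobAlpha_add μ hi
      exact ⟨i, by simp only; omega⟩

theorem Maya.above_ofYoung_frobBeta {μ : YoungDiagram} {i : ℕ} (hi : i < diagLen μ) (n : ℤ) :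
    (Maya.ofYoung μ n).above (n - frobBeta μ i - 1) = μ.colLen i := by
  have hβ := frobBeta_add μ hi
  have hrows : {s : ℤ | s ∈ (Maya.ofYoung μ n).occ ∧ n - frobBeta μ i - 1 < s} =
      (fun k : ℕ => n + μ.rowLen k - k - 1) '' ↑(Finset.range (μ.colLen i)) := by
    have hlt (k : ℕ) : n - frobBeta μ i - 1 < n + μ.rowLen k - k - 1 ↔ k < μ.colLen i := by
      rw [← YoungDiagram.mem_iff_lt_colLen, YoungDiagram.mem_iff_lt_rowLen]
      have hcol := YoungDiagram.mem_iff_lt_colLen (μ := μ) (i := k) (j := i)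
      rw [YoungDiagram.mem_iff_lt_rowLen] at hcol
      omega
    ext x
    constructor
    · rintro ⟨⟨k, rfl⟩, hk⟩
      exact ⟨k, Finset.mem_coe.mpr (Finset.mem_range.mpr ((hlt k).mp hk)), rfl⟩
    · rintro ⟨k, hk, rfl⟩
      exact ⟨⟨k, rfl⟩, (hlt k).mpr (Finset.mem_range.mp (Finset.mem_coe.mp hk))⟩
  rw [Maya.above, hrows, Set.ncard_image_of_injective _ (rowLen_sub_strictAnti μ n).injective,
    Set.ncard_coe_finset, Finset.card_range]

end FrobeniusCoordinates

section BasisStates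

/-- The Maya diagram `T` with the modes `p 0, …, p (r - 1)` filled. -/
def Maya.insertRange (T : Maya) (p : ℕ → ℤ) : ℕ → Maya
  | 0 => T
  | r + 1 => (T.insertRange p r).insert (p r)

theorem Maya.mem_insertRange {T : Maya} {p : ℕ → ℤ} {r : ℕ} {x : ℤ} :
    x ∈ (T.insertRange p r).occ ↔ x ∈ T.occ ∨ ∃ i < r, x = p i := by
  induction r with
  | zero => simp [Maya.insertRange]
  | succ r ih =>
    rw [Maya.insertRange, Maya.mem_insert, ih, Nat.exists_lt_succ_right]
    rw [or_comm, or_assoc]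

theorem Maya.above_insertRange {T : Maya} {p : ℕ → ℤ} {r : ℕ}
    (hp : ∀ i < r, p i ∉ (T.insertRange p i).occ) (k : ℤ) :
    (T.insertRange p r).above k = T.above k + ((Finset.range r).filter fun i => k < p i).card := by
  induction r with
  | zero => simp [Maya.insertRange]
  | succ r ih =>
    rw [Maya.insertRange, Maya.above_insert (hp r r.lt_succ_self), ih fun i hi => hp i (by omega),
      Finset.range_add_one, Finset.filter_insert, add_assoc]
    split_ifs <;> simp

variable {R : Type*} [CommRing R]

theorem wordKet_smul (w : List Fermion) (c : R) (v : Ket R) :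
    wordKet w (c • v) = c • wordKet w v := by
  let _ : TopologicalSpace R := ⊥
  have : DiscreteTopology R := ⟨rfl⟩
  induction w with
  | nil => rfl
  | cons f w ih =>
    refine (congrArg f.ket ih).trans ?_
    cases f with
    | psi k => exact map_smul (psiCLM k) c _
    | psiStar k => exact map_smul (psiStarCLM k) c _

theorem wordKet_psi_ketOf {T : Maya} {p : ℕ → ℤ} {r : ℕ}
    (hp : ∀ i < r, p i ∉ (T.insertRange p i).occ) :
    wordKet ((List.range r).map fun i => Fermion.psi (p i)).reverse (ketOf T : Ket R) =
      (-1 : R) ^ (∑ i ∈ Finset.range r, (T.insertRange p i).above (p i)) •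
        ketOf (T.insertRange p r) := by
  induction r with
  | zero => simp [wordKet, Maya.insertRange]
  | succ r ih =>
    rw [List.range_succ, List.map_append, List.reverse_append, wordKet_append,
      ih fun i hi => hp i (by omega), wordKet_smul, Finset.sum_range_succ, pow_add, mul_smul]
    exact congrArg _ (psiKet_ketOf (hp r r.lt_succ_self))

theorem wordKet_psiStar_ketOf {T : Maya} {p : ℕ → ℤ} {r : ℕ}
    (hp : ∀ i < r, p i ∉ (T.insertRange p i).occ) :
    wordKet ((List.range r).map fun i => Fermion.psiStar (p i))
      (ketOf (T.insertRange p r) : Ket R) =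
      (-1 : R) ^ (∑ i ∈ Finset.range r, (T.insertRange p i).above (p i)) • ketOf T := by
  induction r with
  | zero => simp [wordKet, Maya.insertRange]
  | succ r ih =>
    have hr := hp r r.lt_succ_self
    have hstar : wordKet [Fermion.psiStar (p r)] (ketOf (T.insertRange p (r + 1)) : Ket R) =
        (-1 : R) ^ (T.insertRange p r).above (p r) • ketOf (T.insertRange p r) := by
      have hmem : p r ∈ (T.insertRange p (r + 1)).occ :=
        Maya.mem_insertRange.mpr (Or.inr ⟨r, r.lt_succ_self, rfl⟩)
      refine (psiStarKet_ketOf hmem).trans ?_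
      rw [Maya.insertRange, Maya.above_insert hr, Maya.erase_insert hr, if_neg (lt_irrefl _),
        add_zero]
    rw [List.range_succ, List.map_append, wordKet_append, List.map_singleton, hstar, wordKet_smul,
      ih fun i hi => hp i (by omega), smul_smul, ← pow_add, Finset.sum_range_succ, add_comm]

theorem particle_notMem_insertRange {μ : YoungDiagram} {i : ℕ} (hi : i < diagLen μ) (n : ℤ) :
    n + frobAlpha μ i ∉ ((Maya.vac n).insertRange (fun i => n + frobAlpha μ i) i).occ := by
  rw [Maya.mem_insertRange, Maya.mem_vac]
  rintro (h | ⟨j, hj, h⟩)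
  · omega
  · have hα := frobAlpha_lt_frobAlpha hj hi
    omega

theorem hole_notMem_insertRange {μ : YoungDiagram} {i : ℕ} (hi : i < diagLen μ) (n : ℤ) :
    n - frobBeta μ i - 1 ∉
      ((Maya.ofYoung μ n).insertRange (fun i => n - frobBeta μ i - 1) i).occ := by
  rw [Maya.mem_insertRange, Maya.mem_ofYoung_iff_frob]
  rintro (h | ⟨j, hj, h⟩)
  · exact h.2 i hi rfl
  · have hβ := frobBeta_lt_frobBeta hj hi
    omega

theorem above_particle {μ : YoungDiagram} {i : ℕ} (hi : i < diagLen μ) (n : ℤ) :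
    ((Maya.vac n).insertRange (fun i => n + frobAlpha μ i) i).above (n + frobAlpha μ i) = i := by
  rw [Maya.above_insertRange fun j hj => particle_notMem_insertRange (hj.trans hi) n,
    Maya.above_vac, Finset.filter_true_of_mem, Finset.card_range]
  · omega
  · intro j hj
    have hα := frobAlpha_lt_frobAlpha (Finset.mem_range.mp hj) hi
    omega

theorem above_hole {μ : YoungDiagram} {i : ℕ} (hi : i < diagLen μ) (n : ℤ) :
    ((Maya.ofYoung μ n).insertRange (fun i => n - frobBeta μ i - 1) i).above
      (n - frobBeta μ i - 1) = frobBeta μ i + (i + 1) := by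
  rw [Maya.above_insertRange fun j hj => hole_notMem_insertRange (hj.trans hi) n,
    Maya.above_ofYoung_frobBeta hi, Finset.filter_false_of_mem, Finset.card_empty, add_zero,
    frobBeta_add μ hi]
  intro j hj
  have hβ := frobBeta_lt_frobBeta (Finset.mem_range.mp hj) hi
  omega

theorem insertRange_holes_eq_insertRange_particles (μ : YoungDiagram) (n : ℤ) :
    (Maya.ofYoung μ n).insertRange (fun i => n - frobBeta μ i - 1) (diagLen μ) =
      (Maya.vac n).insertRange (fun i => n + frobAlpha μ i) (diagLen μ) := by
  ext x
  rw [Maya.mem_insertRange, Maya.mem_insertRange, Maya.mem_ofYoung_iff_frob, Maya.mem_vac]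
  constructor
  · rintro (h | ⟨i, -, rfl⟩)
    · exact h.1
    · exact Or.inl (by omega)
  · intro h
    by_cases hx : ∃ i < diagLen μ, x = n - frobBeta μ i - 1
    · exact Or.inr hx
    · push Not at hx
      exact Or.inl ⟨h, hx⟩

theorem ketState_eq (μ : YoungDiagram) (n : ℤ) :
    (ketState μ n : Ket R) = (-1 : R) ^ bNum μ • ketOf (Maya.ofYoung μ n) := by
  have hsign (i : ℕ) :
      (-1 : R) ^ i * (-1) ^ (frobBeta μ i + (i + 1)) = (-1) ^ (frobBeta μ i + 1) := by
    rw [← pow_add, show i + (frobBeta μ i + (i + 1)) = frobBeta μ i + 1 + 2 * i by ring, pow_add,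
      pow_mul _ 2, neg_one_sq, one_pow, mul_one]
  rw [ketState, wordKet_append, ketVac_eq,
    wordKet_psi_ketOf fun i hi => particle_notMem_insertRange hi n, wordKet_smul,
    ← insertRange_holes_eq_insertRange_particles,
    wordKet_psiStar_ketOf fun i hi => hole_notMem_insertRange hi n, smul_smul,
    Finset.sum_congr rfl fun i hi => above_particle (Finset.mem_range.mp hi) n,
    Finset.sum_congr rfl fun i hi => above_hole (Finset.mem_range.mp hi) n]
  simp only [bNum, ← Finset.prod_pow_eq_pow_sum, ← Finset.prod_mul_distrib, hsign]

end BasisStates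

section CoherentStates

variable {R : Type*} [CommRing R]

theorem isFormalSum_smul_ketOf {ι : Type*} {e : ι → Maya} (he : Function.Injective e) {v : Ket R}
    (hv : ∀ S, v S ≠ 0 → S ∈ Set.range e) :
    IsFormalSum (fun i => v (e i) • (ketOf (e i) : Ket R)) v := by
  intro S
  refine ⟨((Set.finite_singleton S).preimage he.injOn).subset fun i hi => ?_, ?_⟩
  · by_contra hne
    exact hi (by simp [ketOf, show S ≠ e i from fun h => hne h.symm])
  · by_cases hS : S ∈ Set.range e
    · obtain ⟨i, rfl⟩ := hS
      rw [finsum_eq_single _ i fun j hj => by simp [ketOf, he.ne hj.symm]]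
      simp [ketOf]
    · rw [not_not.mp (mt (hv S) hS)]
      refine (finsum_congr fun i => ?_).trans finsum_zero
      simp [ketOf, show S ≠ e i from fun h => hS ⟨i, h.symm⟩]

theorem pairing_ketState (μ : YoungDiagram) (n : ℤ) (v : Ket R) :
    pairing (ketState μ n) v = (-1) ^ bNum μ * v (Maya.ofYoung μ n) := by
  rw [pairing, ketState_eq, finsum_eq_single _ (Maya.ofYoung μ n) fun S hS => by simp [ketOf, hS]]
  simp [ketOf]

theorem pairing_comm (U : Bra R) (v : Ket R) : pairing U v = pairing v U :=
  finsum_congr fun _ => mul_comm _ _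

theorem braVac_eq (n : ℤ) : (braVac n : Bra R) = ketVac n := by
  unfold braVac ketVac
  split_ifs <;> rw [wordBra_eq, List.map_map] <;> rfl

theorem braState_eq (μ : YoungDiagram) (n : ℤ) : (braState μ n : Bra R) = ketState μ n := by
  rw [braState, ketState, wordBra_eq, braVac_eq, List.map_append, List.reverse_append,
    List.map_reverse, List.reverse_reverse, List.map_map, List.map_map]
  rfl

variable [Algebra ℚ R]

theorem expJPlus_eq (t : ℕ → R) : expJPlus t = expJMinus t := by
  funext U S
  simp only [expJPlus, expJMinus, JPlus_apply]

theorem isFormalSum_expJMinus_ketVac (t : ℕ → R) (n : ℤ) :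
    IsFormalSum (fun μ : YoungDiagram => ((-1) ^ bNum μ * schur μ t) • (ketState μ n : Ket R))
      (expJMinus t (ketVac n)) := by
  have hsum := isFormalSum_smul_ketOf (Maya.ofYoung_injective n)
    fun _ => mem_range_ofYoung_of_expJMinus_ne_zero t
  rw [ketVac_eq]
  convert hsum using 2 with μ
  rw [ketState_eq, smul_smul, mul_right_comm, ← pow_add, Even.neg_one_pow ⟨_, rfl⟩, one_mul,
    expJMinus_vac_ofYoung]

theorem pairing_ketState_expJMinus_ketVac (t : ℕ → R) (μ : YoungDiagram) (n : ℤ) :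
    pairing (ketState μ n) (expJMinus t (ketVac n)) = (-1) ^ bNum μ * schur μ t := by
  rw [pairing_ketState, ketVac_eq, expJMinus_vac_ofYoung]

end CoherentStates

end FermiFock

theorem mainTheorem3 {R : Type*} [CommRing R] [Algebra ℚ R] (t : ℕ → R) (n : ℤ) :
    FermiFock.IsFormalSum
      (fun μ : YoungDiagram =>
        ((-1) ^ FermiFock.bNum μ * FermiFock.schur μ t) • (FermiFock.ketState μ n : FermiFock.Ket R))
      (FermiFock.expJMinus t (FermiFock.ketVac n)) ∧
    FermiFock.IsFormalSum
      (fun μ : YoungDiagram =>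
        ((-1) ^ FermiFock.bNum μ * FermiFock.schur μ t) • (FermiFock.braState μ n : FermiFock.Bra R))
      (FermiFock.expJPlus t (FermiFock.braVac n)) ∧
    (∀ μ : YoungDiagram,
      FermiFock.pairing (FermiFock.braState μ n) (FermiFock.expJMinus t (FermiFock.ketVac n)) =
        (-1) ^ FermiFock.bNum μ * FermiFock.schur μ t) ∧
    (∀ μ : YoungDiagram,
      FermiFock.pairing (FermiFock.expJPlus t (FermiFock.braVac n)) (FermiFock.ketState μ n) =
        (-1) ^ FermiFock.bNum μ * FermiFock.schur μ t) := by
  open FermiFock in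
  have hsum := isFormalSum_expJMinus_ketVac t n
  have hpairing (μ : YoungDiagram) := pairing_ketState_expJMinus_ketVac t μ n
  simp only [braState_eq, braVac_eq, expJPlus_eq, pairing_comm (expJMinus t _)]
  exact ⟨hsum, hsum, hpairing, hpairing⟩
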